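/- Let $N\ge 1$ be an integer, $0<s<1$ and $1<p<\infty$ with $s\,p>N$, and put $\alpha_{s,p}=s-\frac Np$. For $u:\mathbb{R}^N\to\mathbb{R}$ let \[ [u]^p_{W^{s,p}(\mathbb{R}^N)}=\iint_{\mathbb{R}^N\times\mathbb{R}^N}\frac{|u(x)-u(y)|^p}{|x-y|^{N+s\,p}}\,dx\,dy,\qquad [u]_{C^{0,\alpha_{s,p}}(\mathbb{R}^N)}=\sup_{x\ne y}\frac{|u(x)-u(y)|}{|x-y|^{\alpha_{s,p}}}, \] let $\mathcal{W}^{s,p}(\mathbb{R}^N)$ be the space of continuous functions $u$ on $\mathbb{R}^N$ with $[u]_{C^{0,\alpha_{s,p}}(\mathbb{R}^N)}<\infty$ and $[u]_{W^{s,p}(\mathbb{R}^N)}<\infty$, and let \[ \mathfrak{m}_{s,p}(\mathbb{R}^N)=\inf\Big\{[\varphi]^p_{W^{s,p}(\mathbb{R}^N)}:\ \varphi\in C^\infty_0(\mathbb{R}^N),\ [\varphi]_{C^{0,\alpha_{s,p}}(\mathbb{R}^N)}=1\Big\}. \] A function $u\in\mathcal{W}^{s,p}(\mathbb{R}^N)$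 is called an extremal if it is non-constant and $[u]^p_{W^{s,p}(\mathbb{R}^N)}=\mathfrak{m}_{s,p}(\mathbb{R}^N)\,[u]^p_{C^{0,\alpha_{s,p}}(\mathbb{R}^N)}$. Write $J_p(t)=|t|^{p-2}t$. Let $x_0,y_0\in\mathbb{R}^N$ be two distinct points. For every $u:\mathbb{R}^N\to\mathbb{R}$ the following facts are equivalent: (i) $u\in\mathcal{W}^{s,p}(\mathbb{R}^N)$ is an extremal and $[u]_{C^{0,\alpha_{s,p}}(\mathbb{R}^N)}=\dfrac{|u(x_0)-u(y_0)|}{|x_0-y_0|^{\alpha_{s,p}}}$; (ii) $u\in\mathcal{W}^{s,p}(\mathbb{R}^N)$ weakly solves $(-\Delta_p)^su=c\,(\delta_{x_0}-\delta_{y_0})$ in $\mathbb{R}^N$ for some constant $c\neq0$, that is, \[ \iint_{\mathbb{R}^N\times\mathbb{R}^N}\frac{J_p(u(x)-u(y))\,(\varphi(x)-\varphi(y))}{|x-y|^{N+s\,p}}\,dx\,dy=c\,\big(\varphi(x_0)-\varphi(y_0)\big) \] with an absolutely convergent double integral, for every $\varphi\in\mathcal{W}^{s,p}(\mathbb{R}^N)$;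 (ii') the same as (ii), with the identity required only for every $\varphi\in C^\infty_0(\mathbb{R}^N)$; (iii) $u\in\mathcal{W}^{s,p}(\mathbb{R}^N)$ is non-constant and is the unique minimizer of the problem \[ \inf_{\varphi\in\mathcal{W}^{s,p}(\mathbb{R}^N)}\Big\{[\varphi]^p_{W^{s,p}(\mathbb{R}^N)}:\ \varphi(x_0)=u(x_0)\ \text{and}\ \varphi(y_0)=u(y_0)\Big\}. \] Moreover (uniqueness), if $u,v\in\mathcal{W}^{s,p}(\mathbb{R}^N)$ are two extremals whose $C^{0,\alpha_{s,p}}$ seminorms are both attained at $(x_0,y_0)$ as in (i), and if there is a constant $C\neq0$ with $u(x_0)=C\,v(x_0)$ and $u(y_0)=C\,v(y_0)$, then $u\equiv C\,v$. -/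

import Mathlib

open MeasureTheory
open scoped ENNReal ContDiff

noncomputable section

namespace FractionalMorrey

variable {N : ℕ}

/-- The `p`-th power of the Sobolev-Slobodeckii seminorm on `ℝ^N` (for `0 < s < 1`),
`∬ |u(x) - u(y)|^p / |x - y|^(N + s p) dx dy`, with values in `[0, ∞]`. -/
def slobodeckiiPow (s p : ℝ) (u : EuclideanSpace ℝ (Fin N) → ℝ) : ℝ≥0∞ :=
  ∫⁻ z : EuclideanSpace ℝ (Fin N) × EuclideanSpace ℝ (Fin N),
    ENNReal.ofReal (|u z.1 - u z.2| ^ p / ‖z.1 - z.2‖ ^ ((N : ℝ) + s * p))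

/-- The difference quotient `|u(x) - u(y)| / |x - y|^α`. -/
def holderRatio (α : ℝ) (u : EuclideanSpace ℝ (Fin N) → ℝ)
    (x y : EuclideanSpace ℝ (Fin N)) : ℝ≥0∞ :=
  ENNReal.ofReal (|u x - u y| / ‖x - y‖ ^ α)

/-- The homogeneous `C^{0,α}` seminorm on `ℝ^N`, with values in `[0, ∞]`. -/
def holderSeminorm (α : ℝ) (u : EuclideanSpace ℝ (Fin N) → ℝ) : ℝ≥0∞ :=
  ⨆ (x : EuclideanSpace ℝ (Fin N)) (y : EuclideanSpace ℝ (Fin N)) (_ : x ≠ y), holderRatio α u x y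

/-- The exponent `α_{s,p} = s - N / p`. -/
def morreyExponent (N : ℕ) (s p : ℝ) : ℝ := s - (N : ℝ) / p

/-- The space `𝒲^{s,p}(ℝ^N)`: continuous functions (genuine functions, not classes) with finite
`C^{0,α_{s,p}}` seminorm and finite Sobolev-Slobodeckii seminorm. -/
def spaceW (N : ℕ) (s p : ℝ) : Set (EuclideanSpace ℝ (Fin N) → ℝ) :=
  {u | Continuous u ∧ holderSeminorm (morreyExponent N s p) u < ⊤ ∧ slobodeckiiPow s p u < ⊤}

/-- `C_0^∞(ℝ^N)`: smooth functions with compact support. -/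
def testFunctions (N : ℕ) : Set (EuclideanSpace ℝ (Fin N) → ℝ) :=
  {φ | ContDiff ℝ ∞ φ ∧ HasCompactSupport φ}

/-- The sharp Morrey constant `𝔪_{s,p}(ℝ^N)`, an infimum over `C_0^∞(ℝ^N)`. -/
def morreyConst (N : ℕ) (s p : ℝ) : ℝ≥0∞ :=
  ⨅ φ ∈ {φ ∈ testFunctions N | holderSeminorm (morreyExponent N s p) φ = 1}, slobodeckiiPow s p φ

/-- `u` is not a constant function. -/
def IsNonconstant (u : EuclideanSpace ℝ (Fin N) → ℝ) : Prop := ¬ ∃ k : ℝ, ∀ x, u x = k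

/-- `u` is an extremal for `𝔪_{s,p}(ℝ^N)`. -/
def IsExtremal (s p : ℝ) (u : EuclideanSpace ℝ (Fin N) → ℝ) : Prop :=
  u ∈ spaceW N s p ∧ IsNonconstant u ∧
    slobodeckiiPow s p u = morreyConst N s p * holderSeminorm (morreyExponent N s p) u ^ p

/-- The Hölder seminorm of `u` is attained at the pair `(x₀, y₀)`. -/
def HolderMaximizedAt (s p : ℝ) (u : EuclideanSpace ℝ (Fin N) → ℝ)
    (x₀ y₀ : EuclideanSpace ℝ (Fin N)) : Prop :=
  holderSeminorm (morreyExponent N s p) u = holderRatio (morreyExponent N s p) u x₀ y₀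

/-- `J_p(t) = |t|^(p-2) t`. -/
def Jp (p t : ℝ) : ℝ := |t| ^ (p - 2) * t

/-- The integrand of the weak form of the fractional `p`-Laplacian of order `s`. -/
def fracPLaplaceIntegrand (s p : ℝ) (u φ : EuclideanSpace ℝ (Fin N) → ℝ)
    (z : EuclideanSpace ℝ (Fin N) × EuclideanSpace ℝ (Fin N)) : ℝ :=
  Jp p (u z.1 - u z.2) * (φ z.1 - φ z.2) / ‖z.1 - z.2‖ ^ ((N : ℝ) + s * p)

/-- `u` solves `(-Δ_p)^s u = c (δ_{x₀} - δ_{y₀})` in `ℝ^N` weakly, tested against all functions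
of the class `T`: the double integral converges absolutely and equals `c (φ(x₀) - φ(y₀))`. -/
def WeaklySolves (T : Set (EuclideanSpace ℝ (Fin N) → ℝ)) (s p : ℝ)
    (u : EuclideanSpace ℝ (Fin N) → ℝ) (c : ℝ) (x₀ y₀ : EuclideanSpace ℝ (Fin N)) : Prop :=
  ∀ φ ∈ T, Integrable (fracPLaplaceIntegrand s p u φ) ∧
    ∫ z, fracPLaplaceIntegrand s p u φ z = c * (φ x₀ - φ y₀)

/-- The functions of `𝒲^{s,p}(ℝ^N)` with the values `a` at `x₀` and `b` at `y₀`. -/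
def admissible (s p : ℝ) (x₀ y₀ : EuclideanSpace ℝ (Fin N)) (a b : ℝ) :
    Set (EuclideanSpace ℝ (Fin N) → ℝ) :=
  {φ ∈ spaceW N s p | φ x₀ = a ∧ φ y₀ = b}

/-- `u` is the unique minimizer of the functional `F` on the set `A`. -/
def IsUniqueMinimizer (F : (EuclideanSpace ℝ (Fin N) → ℝ) → ℝ≥0∞)
    (A : Set (EuclideanSpace ℝ (Fin N) → ℝ)) (u : EuclideanSpace ℝ (Fin N) → ℝ) : Prop :=
  (u ∈ A ∧ IsMinOn F A u) ∧ ∀ v, v ∈ A ∧ IsMinOn F A v → v = u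

end FractionalMorrey

end

/-! Write E for the p-th power of the Sobolev-Slobodeckii seminorm and α for the Morrey exponent.
Convexity and scaling carry the proof.

The strict tangent inequality `tangent_lt`, integrated against the kernel, makes E strictly convex
modulo constants, with p times the weak form as its linear term. A weak solution therefore minimizes
E uniquely among functions with its values at the two points. Conversely, minimality annihilates the
weak form on functions vanishing at both points, and every φ is such a function plus a multiple of u
plus a constant, so the weak form is a multiple of φ(x₀) - φ(y₀).

An extremal attaining its Hölder seminorm at the pair is a minimizer, since each competitor has the
same quotient there and hence at least as large a seminorm; `morreyConst_mul_le` then compares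
energies. In the other direction, E and the p-th power of the Hölder seminorm are both multiplied by
l^(αp) under a dilation by l. Any function can thus be moved by a similarity, so that an arbitrary
pair replaces (x₀, y₀), and then made admissible by an affine change of values. This yields the
sharp comparison `slobodeckiiPow_mul_holderRatio_le`.

Passing from test functions to the whole space uses only pointwise approximation with no excess
energy in the limit (`exists_seq_testFunctions`), available because N < sp lets cutoffs of vanishing
energy tend to infinity everywhere. This suffices for Morrey's inequality and, through Fatou's lemma
for the gap in Young's inequality, for the weak equation. -/

namespace FractionalMorrey

/-! ### Scalar inequalities: convexity of |t|^p and truncation -/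

section Scalar

variable {p : ℝ}

lemma abs_Jp (hp : 1 < p) (a : ℝ) : |Jp p a| = |a| ^ (p - 1) := by
  rcases eq_or_ne a 0 with rfl | ha
  · simp [Jp, Real.zero_rpow (by linarith : p - 1 ≠ 0)]
  · rw [Jp, abs_mul, abs_of_nonneg (by positivity : (0 : ℝ) ≤ |a| ^ (p - 2)),
      ← Real.rpow_add_one (abs_pos.2 ha).ne']
    ring_nf

lemma Jp_mul_self (hp : 1 < p) (a : ℝ) : Jp p a * a = |a| ^ p := by
  rcases eq_or_ne a 0 with rfl | ha
  · simp [Jp, Real.zero_rpow (by linarith : p ≠ 0)]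
  · have h := abs_pos.2 ha
    rw [Jp, mul_assoc, ← abs_mul_abs_self a, ← mul_assoc, ← Real.rpow_add_one h.ne',
      ← Real.rpow_add_one h.ne']
    ring_nf

/-- For p < 2 the factor |t|^(p-2) is singular at 0; this form has only positive powers, so
continuity is visible. -/
lemma Jp_eq_max (hp : 1 < p) (a : ℝ) :
    Jp p a = (max a 0) ^ (p - 1) - (max (-a) 0) ^ (p - 1) := by
  have h0 : p - 1 ≠ 0 := by linarith
  rcases lt_trichotomy a 0 with ha | rfl | ha
  · rw [max_eq_right ha.le, max_eq_left (by linarith), Real.zero_rpow h0, Jp, abs_of_neg ha,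
      show p - 1 = p - 2 + 1 by ring, Real.rpow_add_one (by linarith)]
    ring
  · simp [Jp]
  · rw [max_eq_left ha.le, max_eq_right (by linarith), Real.zero_rpow h0, Jp, abs_of_pos ha,
      show p - 1 = p - 2 + 1 by ring, Real.rpow_add_one (by linarith)]
    ring

lemma continuous_Jp (hp : 1 < p) : Continuous (Jp p) := by
  rw [funext (Jp_eq_max hp)]
  exact ((continuous_id.max continuous_const).rpow_const fun _ => Or.inr (by linarith)).sub
    ((continuous_neg.max continuous_const).rpow_const fun _ => Or.inr (by linarith))

lemma Jp_neg (a : ℝ) : Jp p (-a) = -Jp p a := by simp [Jp]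

/-- After division by a^p this is the strict Bernoulli inequality at b/a - 1 when b ≥ 0; when b < 0
the left side is already negative. -/
lemma tangent_lt_of_pos (hp : 1 < p) {a b : ℝ} (ha : 0 < a) (hab : a ≠ b) :
    |a| ^ p + p * (Jp p a * (b - a)) < |b| ^ p := by
  have key : |a| ^ p + p * (Jp p a * (b - a)) = a ^ p * (1 + p * (b / a - 1)) := by
    have h : Jp p a = a ^ p / a := by
      rw [eq_div_iff ha.ne', Jp_mul_self hp, abs_of_pos ha]
    rw [h, abs_of_pos ha]
    field_simp
  rw [key]
  have hap : 0 < a ^ p := Real.rpow_pos_of_pos ha p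
  rcases le_or_gt 0 b with hb | hb
  · have hs : -1 ≤ b / a - 1 := by have : 0 ≤ b / a := by positivity
                                   linarith
    have hs' : b / a - 1 ≠ 0 := by
      rw [sub_ne_zero, Ne, div_eq_one_iff_eq ha.ne']; exact hab.symm
    have h := one_add_mul_self_lt_rpow_one_add hs hs' hp
    calc _ < a ^ p * (1 + (b / a - 1)) ^ p := mul_lt_mul_of_pos_left h hap
      _ = |b| ^ p := by
        rw [add_sub_cancel, ← Real.mul_rpow ha.le (by positivity), mul_div_cancel₀ _ ha.ne',
          abs_of_nonneg hb]
  · have h1 : b / a < 0 := div_neg_of_neg_of_pos hb ha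
    have h2 : 1 + p * (b / a - 1) < 0 := by nlinarith
    have h3 : 0 ≤ |b| ^ p := by positivity
    nlinarith [mul_neg_of_pos_of_neg hap h2]

lemma tangent_lt (hp : 1 < p) {a b : ℝ} (hab : a ≠ b) :
    |a| ^ p + p * (Jp p a * (b - a)) < |b| ^ p := by
  rcases lt_trichotomy a 0 with ha | rfl | ha
  · have h := tangent_lt_of_pos hp (a := -a) (b := -b) (by linarith) (by simpa using hab)
    rw [abs_neg, abs_neg, Jp_neg] at h
    linarith
  · have : 0 < |b| ^ p := Real.rpow_pos_of_pos (abs_pos.2 hab.symm) p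
    simpa [Jp, Real.zero_rpow (by linarith : p ≠ 0)] using this
  · exact tangent_lt_of_pos hp ha hab

lemma tangent_le (hp : 1 < p) (a b : ℝ) :
    |a| ^ p + p * (Jp p a * (b - a)) ≤ |b| ^ p := by
  rcases eq_or_ne a b with rfl | hab
  · simp
  · exact (tangent_lt hp hab).le

lemma abs_add_rpow_le (hp : 0 ≤ p) (a b : ℝ) :
    |a + b| ^ p ≤ 2 ^ p * (|a| ^ p + |b| ^ p) := by
  wlog h : |a| ≤ |b| generalizing a b
  · rw [add_comm a, add_comm (|a| ^ p)]
    exact this b a (le_of_not_ge h)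
  · calc |a + b| ^ p ≤ (2 * |b|) ^ p := by
          gcongr
          linarith [abs_add_le a b]
      _ = 2 ^ p * |b| ^ p := Real.mul_rpow (by norm_num) (abs_nonneg b)
      _ ≤ _ := by
          gcongr
          have : 0 ≤ |a| ^ p := by positivity
          linarith

/-- Replace the smaller of |a|, |b| by the larger. This crude Young bound gives absolute convergence
of the weak form. -/
lemma abs_Jp_mul_le (hp : 1 < p) (a b : ℝ) : |Jp p a * b| ≤ |a| ^ p + |b| ^ p := by
  rw [abs_mul, abs_Jp hp]
  have key : ∀ m : ℝ, 0 ≤ m → m ^ (p - 1) * m = m ^ p := fun m hm => by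
    rw [← Real.rpow_add_one' hm (by linarith)]; ring_nf
  have ha : 0 ≤ |a| ^ p := by positivity
  have hb : 0 ≤ |b| ^ p := by positivity
  rcases le_total |a| |b| with h | h
  · calc |a| ^ (p - 1) * |b| ≤ |b| ^ (p - 1) * |b| := by gcongr
      _ = |b| ^ p := key _ (abs_nonneg b)
      _ ≤ _ := by linarith
  · calc |a| ^ (p - 1) * |b| ≤ |a| ^ (p - 1) * |a| := by gcongr
      _ = |a| ^ p := key _ (abs_nonneg a)
      _ ≤ _ := by linarith

lemma abs_clamp_sub_le (a b c d : ℝ) :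
    |max (min a c) (-c) - max (min b d) (-d)| ≤ max |a - b| |c - d| := by
  refine (abs_max_sub_max_le_max _ _ _ _).trans (max_le ?_ ?_)
  · exact abs_min_sub_min_le_max _ _ _ _
  · rw [show -c - -d = -(c - d) by ring, abs_neg]
    exact le_max_right _ _

end Scalar

end FractionalMorrey

/-! ### The energy density and the vector space structure of 𝒲 -/

namespace FractionalMorrey

variable {N : ℕ} {s p : ℝ} {u v φ : EuclideanSpace ℝ (Fin N) → ℝ}

/-- The integrand of `slobodeckiiPow`. -/
noncomputable def energyDensity (s p : ℝ) (u : EuclideanSpace ℝ (Fin N) → ℝ)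
    (z : EuclideanSpace ℝ (Fin N) × EuclideanSpace ℝ (Fin N)) : ℝ :=
  |u z.1 - u z.2| ^ p / ‖z.1 - z.2‖ ^ ((N : ℝ) + s * p)

lemma slobodeckiiPow_eq (s p : ℝ) (u : EuclideanSpace ℝ (Fin N) → ℝ) :
    slobodeckiiPow s p u = ∫⁻ z, ENNReal.ofReal (energyDensity s p u z) := rfl

lemma energyDensity_nonneg (s p : ℝ) (u : EuclideanSpace ℝ (Fin N) → ℝ)
    (z : EuclideanSpace ℝ (Fin N) × EuclideanSpace ℝ (Fin N)) : 0 ≤ energyDensity s p u z := by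
  unfold energyDensity; positivity

lemma measurable_energyDensity (hu : Continuous u) : Measurable (energyDensity s p u) := by
  unfold energyDensity
  have := hu.measurable
  fun_prop

lemma measurable_fracPLaplaceIntegrand (hp : 1 < p) (hu : Continuous u) (hφ : Continuous φ) :
    Measurable (fracPLaplaceIntegrand s p u φ) := by
  unfold fracPLaplaceIntegrand
  have h1 := hu.measurable
  have h2 := hφ.measurable
  have h3 := (continuous_Jp hp).measurable
  exact ((h3.comp (by fun_prop)).mul (by fun_prop)).div (by fun_prop)

section Space

lemma integrable_energyDensity (hu : u ∈ spaceW N s p) : Integrable (energyDensity s p u) := by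
  refine ⟨(measurable_energyDensity hu.1).aestronglyMeasurable, ?_⟩
  rw [hasFiniteIntegral_iff_ofReal (ae_of_all _ (energyDensity_nonneg s p u))]
  exact hu.2.2

lemma slobodeckiiPow_eq_ofReal (hu : u ∈ spaceW N s p) :
    slobodeckiiPow s p u = ENNReal.ofReal (∫ z, energyDensity s p u z) := by
  rw [slobodeckiiPow_eq, ofReal_integral_eq_lintegral_ofReal (integrable_energyDensity hu)
    (ae_of_all _ (energyDensity_nonneg s p u))]

lemma slobodeckiiPow_le_iff (hu : u ∈ spaceW N s p) (hv : v ∈ spaceW N s p) :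
    slobodeckiiPow s p u ≤ slobodeckiiPow s p v ↔
      ∫ z, energyDensity s p u z ≤ ∫ z, energyDensity s p v z := by
  rw [slobodeckiiPow_eq_ofReal hu, slobodeckiiPow_eq_ofReal hv, ENNReal.ofReal_le_ofReal_iff]
  exact integral_nonneg (energyDensity_nonneg s p v)

lemma slobodeckiiPow_add_le (hp : 0 ≤ p) (hu : Continuous u) :
    slobodeckiiPow s p (u + v) ≤
      ENNReal.ofReal (2 ^ p) * (slobodeckiiPow s p u + slobodeckiiPow s p v) := by
  have hm : Measurable fun z => ENNReal.ofReal (energyDensity s p u z) :=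
    (measurable_energyDensity hu).ennreal_ofReal
  simp only [slobodeckiiPow_eq]
  rw [← lintegral_add_left hm, ← lintegral_const_mul' _ _ ENNReal.ofReal_ne_top]
  refine lintegral_mono fun z => ?_
  rw [← ENNReal.ofReal_add (energyDensity_nonneg _ _ _ _) (energyDensity_nonneg _ _ _ _),
    ← ENNReal.ofReal_mul (by positivity)]
  refine ENNReal.ofReal_le_ofReal ?_
  have h := abs_add_rpow_le hp (u z.1 - u z.2) (v z.1 - v z.2)
  simp only [energyDensity, Pi.add_apply]
  rw [← add_div, ← mul_div_assoc, show u z.1 + v z.1 - (u z.2 + v z.2) =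
    u z.1 - u z.2 + (v z.1 - v z.2) by ring]
  gcongr

lemma slobodeckiiPow_smul (C : ℝ) (u : EuclideanSpace ℝ (Fin N) → ℝ) :
    slobodeckiiPow s p (C • u) = ENNReal.ofReal (|C| ^ p) * slobodeckiiPow s p u := by
  simp only [slobodeckiiPow_eq]
  rw [← lintegral_const_mul' _ _ ENNReal.ofReal_ne_top]
  refine lintegral_congr fun z => ?_
  rw [← ENNReal.ofReal_mul (by positivity)]
  simp only [energyDensity, Pi.smul_apply, smul_eq_mul]
  rw [← mul_sub, abs_mul, Real.mul_rpow (abs_nonneg _) (abs_nonneg _), mul_div_assoc]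

lemma slobodeckiiPow_const (hp : p ≠ 0) (k : ℝ) :
    slobodeckiiPow s p (fun _ : EuclideanSpace ℝ (Fin N) => k) = 0 := by
  simp [slobodeckiiPow, Real.zero_rpow hp]

lemma holderRatio_add_le (α : ℝ) (u v : EuclideanSpace ℝ (Fin N) → ℝ)
    (x y : EuclideanSpace ℝ (Fin N)) :
    holderRatio α (u + v) x y ≤ holderRatio α u x y + holderRatio α v x y := by
  unfold holderRatio
  rw [← ENNReal.ofReal_add (by positivity) (by positivity), ← add_div]
  refine ENNReal.ofReal_le_ofReal ?_
  gcongr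
  rw [Pi.add_apply, Pi.add_apply, add_sub_add_comm]
  exact abs_add_le _ _

lemma holderRatio_smul (α C : ℝ) (u : EuclideanSpace ℝ (Fin N) → ℝ)
    (x y : EuclideanSpace ℝ (Fin N)) :
    holderRatio α (C • u) x y = ENNReal.ofReal |C| * holderRatio α u x y := by
  unfold holderRatio
  rw [← ENNReal.ofReal_mul (abs_nonneg C)]
  simp only [Pi.smul_apply, smul_eq_mul]
  rw [← mul_sub, abs_mul, mul_div_assoc]

lemma holderRatio_le_holderSeminorm (α : ℝ) (u : EuclideanSpace ℝ (Fin N) → ℝ)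
    (x y : EuclideanSpace ℝ (Fin N)) : holderRatio α u x y ≤ holderSeminorm α u := by
  rcases eq_or_ne x y with rfl | h
  · simp [holderRatio]
  · exact le_iSup_of_le x (le_iSup_of_le y (le_iSup_of_le h le_rfl))

lemma holderSeminorm_le_iff (α : ℝ) (u : EuclideanSpace ℝ (Fin N) → ℝ) {c : ℝ≥0∞} :
    holderSeminorm α u ≤ c ↔ ∀ x y, x ≠ y → holderRatio α u x y ≤ c := by
  simp [holderSeminorm, iSup_le_iff]

lemma holderSeminorm_add_le (α : ℝ) (u v : EuclideanSpace ℝ (Fin N) → ℝ) :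
    holderSeminorm α (u + v) ≤ holderSeminorm α u + holderSeminorm α v :=
  (holderSeminorm_le_iff _ _).2 fun x y _ => (holderRatio_add_le α u v x y).trans
    (add_le_add (holderRatio_le_holderSeminorm α u x y) (holderRatio_le_holderSeminorm α v x y))

lemma holderSeminorm_smul (α C : ℝ) (u : EuclideanSpace ℝ (Fin N) → ℝ) :
    holderSeminorm α (C • u) = ENNReal.ofReal |C| * holderSeminorm α u := by
  simp only [holderSeminorm, ENNReal.mul_iSup, holderRatio_smul]

lemma holderSeminorm_const (α k : ℝ) :
    holderSeminorm α (fun _ : EuclideanSpace ℝ (Fin N) => k) = 0 := by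
  simp [holderSeminorm, holderRatio]

lemma add_mem_spaceW (hp : 0 ≤ p) (hu : u ∈ spaceW N s p) (hv : v ∈ spaceW N s p) :
    u + v ∈ spaceW N s p :=
  ⟨hu.1.add hv.1, (holderSeminorm_add_le _ _ _).trans_lt (ENNReal.add_lt_top.2 ⟨hu.2.1, hv.2.1⟩),
    (slobodeckiiPow_add_le hp hu.1).trans_lt (ENNReal.mul_lt_top ENNReal.ofReal_lt_top
      (ENNReal.add_lt_top.2 ⟨hu.2.2, hv.2.2⟩))⟩

lemma smul_mem_spaceW (C : ℝ) (hu : u ∈ spaceW N s p) : C • u ∈ spaceW N s p :=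
  ⟨hu.1.const_smul C,
    by rw [holderSeminorm_smul]; exact ENNReal.mul_lt_top ENNReal.ofReal_lt_top hu.2.1,
    by rw [slobodeckiiPow_smul]; exact ENNReal.mul_lt_top ENNReal.ofReal_lt_top hu.2.2⟩

lemma const_mem_spaceW (hp : p ≠ 0) (k : ℝ) :
    (fun _ : EuclideanSpace ℝ (Fin N) => k) ∈ spaceW N s p :=
  ⟨continuous_const, by simp [holderSeminorm_const], by simp [slobodeckiiPow_const hp]⟩

lemma sub_mem_spaceW (hp : 0 ≤ p) (hu : u ∈ spaceW N s p) (hv : v ∈ spaceW N s p) :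
    u - v ∈ spaceW N s p := by
  have := add_mem_spaceW hp hu (smul_mem_spaceW (-1) hv)
  rwa [neg_one_smul, ← sub_eq_add_neg] at this

end Space

/-! ### Convexity of the energy, minimizers and weak solutions -/

section FirstVariation

variable {ψ : EuclideanSpace ℝ (Fin N) → ℝ} {x₀ y₀ : EuclideanSpace ℝ (Fin N)} {c : ℝ}

lemma fracPLaplaceIntegrand_self (hp : 1 < p) :
    fracPLaplaceIntegrand s p u u = energyDensity s p u := by
  funext z
  simp [fracPLaplaceIntegrand, energyDensity, Jp_mul_self hp]

lemma abs_fracPLaplaceIntegrand_le (hp : 1 < p)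
    (z : EuclideanSpace ℝ (Fin N) × EuclideanSpace ℝ (Fin N)) :
    |fracPLaplaceIntegrand s p u φ z| ≤ energyDensity s p u z + energyDensity s p φ z := by
  unfold fracPLaplaceIntegrand energyDensity
  rw [← add_div, abs_div, abs_of_nonneg (by positivity : 0 ≤ ‖z.1 - z.2‖ ^ ((N : ℝ) + s * p))]
  gcongr
  exact abs_Jp_mul_le hp _ _

lemma integrable_fracPLaplaceIntegrand (hp : 1 < p) (hu : u ∈ spaceW N s p)
    (hφ : φ ∈ spaceW N s p) : Integrable (fracPLaplaceIntegrand s p u φ) :=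
  ((integrable_energyDensity hu).add (integrable_energyDensity hφ)).mono'
    (measurable_fracPLaplaceIntegrand hp hu.1 hφ.1).aestronglyMeasurable
    (ae_of_all _ fun z => abs_fracPLaplaceIntegrand_le hp z)

lemma fracPLaplaceIntegrand_add (u φ ψ : EuclideanSpace ℝ (Fin N) → ℝ) :
    fracPLaplaceIntegrand s p u (φ + ψ) =
      fracPLaplaceIntegrand s p u φ + fracPLaplaceIntegrand s p u ψ := by
  funext z
  simp only [fracPLaplaceIntegrand, Pi.add_apply]
  ring

lemma fracPLaplaceIntegrand_smul (C : ℝ) (u φ : EuclideanSpace ℝ (Fin N) → ℝ) :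
    fracPLaplaceIntegrand s p u (C • φ) = C • fracPLaplaceIntegrand s p u φ := by
  funext z
  simp only [fracPLaplaceIntegrand, Pi.smul_apply, smul_eq_mul]
  ring

lemma energyDensity_tangent_le (hp : 1 < p) (u v : EuclideanSpace ℝ (Fin N) → ℝ)
    (z : EuclideanSpace ℝ (Fin N) × EuclideanSpace ℝ (Fin N)) :
    energyDensity s p u z + p * fracPLaplaceIntegrand s p u (v - u) z ≤ energyDensity s p v z := by
  have h := tangent_le hp (u z.1 - u z.2) (v z.1 - v z.2)
  simp only [energyDensity, fracPLaplaceIntegrand, Pi.sub_apply]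
  rw [← mul_div_assoc, ← add_div]
  gcongr
  rwa [show v z.1 - u z.1 - (v z.2 - u z.2) = v z.1 - v z.2 - (u z.1 - u z.2) by ring]

lemma integral_energyDensity_tangent_le (hp : 1 < p) (hu : u ∈ spaceW N s p)
    (hv : v ∈ spaceW N s p) :
    (∫ z, energyDensity s p u z) + p * ∫ z, fracPLaplaceIntegrand s p u (v - u) z ≤
      ∫ z, energyDensity s p v z := by
  have h1 := integrable_energyDensity hu
  have h2 := integrable_fracPLaplaceIntegrand hp hu (sub_mem_spaceW (by linarith) hv hu)
  rw [← integral_const_mul, ← integral_add h1 (h2.const_mul p)]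
  exact integral_mono (h1.add (h2.const_mul p)) (integrable_energyDensity hv)
    (energyDensity_tangent_le hp u v)

lemma sub_eq_sub_of_ae (hu : Continuous u) (hv : Continuous v)
    (h : ∀ᵐ z : EuclideanSpace ℝ (Fin N) × EuclideanSpace ℝ (Fin N),
      u z.1 - u z.2 = v z.1 - v z.2) (x y : EuclideanSpace ℝ (Fin N)) :
    u x - u y = v x - v y := by
  have := (Continuous.ae_eq_iff_eq (μ := volume)
    (f := fun z : EuclideanSpace ℝ (Fin N) × EuclideanSpace ℝ (Fin N) => u z.1 - u z.2)
    (g := fun z => v z.1 - v z.2) (by fun_prop) (by fun_prop)).1 h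
  exact congrFun this (x, y)

/-- Equality case of convexity: a nonnegative gap with zero integral vanishes a.e., strictness of
`tangent_lt` forces equal differences a.e., and continuity gives them everywhere. -/
lemma sub_eq_sub_of_tangent_eq (hp : 1 < p) (hu : u ∈ spaceW N s p) (hv : v ∈ spaceW N s p)
    (h : ∫ z, energyDensity s p v z ≤
      (∫ z, energyDensity s p u z) + p * ∫ z, fracPLaplaceIntegrand s p u (v - u) z)
    (x y : EuclideanSpace ℝ (Fin N)) : u x - u y = v x - v y := by
  have h1 := integrable_energyDensity hu
  have h2 := integrable_fracPLaplaceIntegrand hp hu (sub_mem_spaceW (by linarith) hv hu)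
  have h3 : Integrable fun z =>
      energyDensity s p u z + p * fracPLaplaceIntegrand s p u (v - u) z := h1.add (h2.const_mul p)
  have heq : (∫ z, energyDensity s p v z) -
      ∫ z, (energyDensity s p u z + p * fracPLaplaceIntegrand s p u (v - u) z) = 0 := by
    rw [integral_add h1 (h2.const_mul p), integral_const_mul]
    linarith [integral_energyDensity_tangent_le hp hu hv]
  rw [← integral_sub (integrable_energyDensity hv) h3, integral_eq_zero_iff_of_nonneg
    (fun z => sub_nonneg.2 (energyDensity_tangent_le hp u v z))
    ((integrable_energyDensity hv).sub h3)] at heq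
  refine sub_eq_sub_of_ae hu.1 hv.1 ?_ x y
  filter_upwards [heq] with z hz
  by_contra hne
  -- On the diagonal both differences vanish, so `hne` excludes it and the kernel is positive.
  have hz' : 0 < ‖z.1 - z.2‖ := by
    rw [norm_pos_iff, sub_ne_zero]
    intro h; simp [h] at hne
  have hk : 0 < ‖z.1 - z.2‖ ^ ((N : ℝ) + s * p) := Real.rpow_pos_of_pos hz' _
  have h := div_lt_div_of_pos_right (tangent_lt hp hne) hk
  simp only [energyDensity, fracPLaplaceIntegrand, Pi.sub_apply, Pi.zero_apply] at hz
  rw [add_div, mul_div_assoc] at h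
  rw [show v z.1 - u z.1 - (v z.2 - u z.2) = v z.1 - v z.2 - (u z.1 - u z.2) by ring] at hz
  linarith

/-- The equality case with the zero function as base point. -/
lemma eq_const_of_integral_energyDensity_le_zero (hp : 1 < p) (hu : u ∈ spaceW N s p)
    (h : ∫ z, energyDensity s p u z ≤ 0) (x y : EuclideanSpace ℝ (Fin N)) : u x = u y := by
  have h0 := const_mem_spaceW (N := N) (s := s) (by linarith : p ≠ 0) 0
  have := sub_eq_sub_of_tangent_eq hp h0 hu (by
    simpa [energyDensity, fracPLaplaceIntegrand, Jp, Real.zero_rpow (by linarith : p ≠ 0)] using h)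
    x y
  simp at this
  linarith

lemma integral_energyDensity_pos (hp : 1 < p) (hu : u ∈ spaceW N s p) (h : IsNonconstant u) :
    0 < ∫ z, energyDensity s p u z := by
  by_contra hle
  exact h ⟨u 0, fun x => eq_const_of_integral_energyDensity_le_zero hp hu (not_lt.1 hle) x 0⟩

open Filter Topology in
lemma tendsto_integral_fracPLaplaceIntegrand (hp : 1 < p) (hu : u ∈ spaceW N s p)
    (hψ : ψ ∈ spaceW N s p) :
    Tendsto (fun t : ℝ => ∫ z, fracPLaplaceIntegrand s p (u + t • ψ) ψ z) (𝓝[>] 0)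
      (𝓝 (∫ z, fracPLaplaceIntegrand s p u ψ z)) := by
  refine tendsto_integral_filter_of_dominated_convergence
    (fun z => 2 ^ p * (energyDensity s p u z + energyDensity s p ψ z) + energyDensity s p ψ z)
    (Eventually.of_forall fun t => (measurable_fracPLaplaceIntegrand hp
      (hu.1.add (hψ.1.const_smul t)) hψ.1).aestronglyMeasurable) ?_
    ((((integrable_energyDensity hu).add (integrable_energyDensity hψ)).const_mul _).add
      (integrable_energyDensity hψ)) (ae_of_all _ fun z => ?_)
  · have h1 : ∀ᶠ t : ℝ in 𝓝[>] 0, t < 1 := nhdsWithin_le_nhds (gt_mem_nhds one_pos)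
    filter_upwards [h1, self_mem_nhdsWithin] with t ht1 ht0
    refine ae_of_all _ fun z => (abs_fracPLaplaceIntegrand_le hp z).trans ?_
    gcongr
    have h := abs_add_rpow_le (by linarith : 0 ≤ p) (u z.1 - u z.2) (t * (ψ z.1 - ψ z.2))
    have h' : |t * (ψ z.1 - ψ z.2)| ^ p ≤ |ψ z.1 - ψ z.2| ^ p := by
      refine Real.rpow_le_rpow (abs_nonneg _) ?_ (by linarith)
      rw [abs_mul, abs_of_pos ht0]
      nlinarith [abs_nonneg (ψ z.1 - ψ z.2)]
    simp only [energyDensity, Pi.add_apply, Pi.smul_apply, smul_eq_mul]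
    rw [← add_div, ← mul_div_assoc, show u z.1 + t * ψ z.1 - (u z.2 + t * ψ z.2) =
      u z.1 - u z.2 + t * (ψ z.1 - ψ z.2) by ring]
    gcongr
    refine h.trans ?_
    gcongr
  · have hc : Continuous fun t : ℝ => fracPLaplaceIntegrand s p (u + t • ψ) ψ z := by
      unfold fracPLaplaceIntegrand
      have := continuous_Jp hp
      simp only [Pi.add_apply, Pi.smul_apply, smul_eq_mul]
      exact ((this.comp (by fun_prop)).mul continuous_const).div_const _
    have := (hc.tendsto 0).mono_left (nhdsWithin_le_nhds (s := Set.Ioi 0))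
    simpa using this

/-- The tangent inequality based at u + tψ and evaluated at u, combined with minimality of u, gives
a nonnegative pairing for each t > 0. Letting t decrease to 0 avoids differentiating the energy. -/
lemma integral_fracPLaplaceIntegrand_nonneg_of_isMinOn (hp : 1 < p) (hu : u ∈ spaceW N s p)
    (hψ : ψ ∈ spaceW N s p)
    (hmin : ∀ t : ℝ, slobodeckiiPow s p u ≤ slobodeckiiPow s p (u + t • ψ)) :
    0 ≤ ∫ z, fracPLaplaceIntegrand s p u ψ z := by
  refine ge_of_tendsto (tendsto_integral_fracPLaplaceIntegrand hp hu hψ) ?_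
  filter_upwards [self_mem_nhdsWithin] with t ht
  have ht : 0 < t := ht
  have hv := add_mem_spaceW (by linarith) hu (smul_mem_spaceW t hψ)
  have h1 := (slobodeckiiPow_le_iff hu hv).1 (hmin t)
  have h2 := integral_energyDensity_tangent_le hp hv hu
  rw [show u - (u + t • ψ) = (-t) • ψ by rw [neg_smul]; abel, fracPLaplaceIntegrand_smul] at h2
  simp only [Pi.smul_apply, smul_eq_mul, integral_const_mul] at h2
  by_contra hneg
  push Not at hneg
  have := mul_pos_of_neg_of_neg (neg_neg_of_pos ht) hneg
  nlinarith

lemma integral_fracPLaplaceIntegrand_eq_zero_of_isMinOn (hp : 1 < p) (hu : u ∈ spaceW N s p)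
    (hψ : ψ ∈ spaceW N s p)
    (hmin : ∀ t : ℝ, slobodeckiiPow s p u ≤ slobodeckiiPow s p (u + t • ψ)) :
    ∫ z, fracPLaplaceIntegrand s p u ψ z = 0 := by
  refine le_antisymm ?_ (integral_fracPLaplaceIntegrand_nonneg_of_isMinOn hp hu hψ hmin)
  have h := integral_fracPLaplaceIntegrand_nonneg_of_isMinOn hp hu (smul_mem_spaceW (-1) hψ)
    fun t => by rw [smul_smul]; exact hmin _
  rw [fracPLaplaceIntegrand_smul] at h
  simp only [Pi.smul_apply, smul_eq_mul, integral_const_mul] at h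
  linarith

/-- Were the two values equal, a constant would be a competitor of zero energy. -/
lemma ne_of_isMinOn (hp : 1 < p) (hu : u ∈ spaceW N s p) (hnc : IsNonconstant u)
    (hmin : IsMinOn (slobodeckiiPow s p) (admissible s p x₀ y₀ (u x₀) (u y₀)) u) :
    u x₀ ≠ u y₀ := by
  intro h
  have hk := const_mem_spaceW (N := N) (s := s) (by linarith : p ≠ 0) (u x₀)
  have h1 : slobodeckiiPow s p u ≤ slobodeckiiPow s p fun _ => u x₀ :=
    hmin ⟨hk, rfl, h⟩
  rw [slobodeckiiPow_const (by linarith), slobodeckiiPow_eq_ofReal hu, nonpos_iff_eq_zero,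
    ENNReal.ofReal_eq_zero] at h1
  exact absurd (integral_energyDensity_pos hp hu hnc) (not_lt.2 h1)

lemma exists_weaklySolves_of_isMinOn (hp : 1 < p) (hu : u ∈ spaceW N s p) (hnc : IsNonconstant u)
    (hmin : IsMinOn (slobodeckiiPow s p) (admissible s p x₀ y₀ (u x₀) (u y₀)) u) :
    ∃ c : ℝ, c ≠ 0 ∧ WeaklySolves (spaceW N s p) s p u c x₀ y₀ := by
  have hne := ne_of_isMinOn hp hu hnc hmin
  have hd : u x₀ - u y₀ ≠ 0 := sub_ne_zero.2 hne
  have hpos := integral_energyDensity_pos hp hu hnc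
  have hp0 : 0 ≤ p := by linarith
  -- The constant is dictated by testing with u itself.
  refine ⟨(∫ z, energyDensity s p u z) / (u x₀ - u y₀), div_ne_zero hpos.ne' hd, fun φ hφ =>
    ⟨integrable_fracPLaplaceIntegrand hp hu hφ, ?_⟩⟩
  -- This makes φ - a u take equal values at the two points; subtracting the constant `κ` then makes
  -- both zero.
  set a := (φ x₀ - φ y₀) / (u x₀ - u y₀) with ha
  have hk := const_mem_spaceW (N := N) (s := s) (by linarith : p ≠ 0) (φ y₀ - a * u y₀)
  set κ : EuclideanSpace ℝ (Fin N) → ℝ := fun _ => φ y₀ - a * u y₀ with hκ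
  have hψ : φ - a • u - κ ∈ spaceW N s p :=
    sub_mem_spaceW hp0 (sub_mem_spaceW hp0 hφ (smul_mem_spaceW a hu)) hk
  have hψx : (φ - a • u - κ) x₀ = 0 := by
    simp only [Pi.sub_apply, Pi.smul_apply, smul_eq_mul, hκ, ha]
    field_simp
    ring
  have hψy : (φ - a • u - κ) y₀ = 0 := by simp [hκ]
  have hzero := integral_fracPLaplaceIntegrand_eq_zero_of_isMinOn hp hu hψ fun t =>
    hmin ⟨add_mem_spaceW hp0 hu (smul_mem_spaceW t hψ), by
      rw [Pi.add_apply, Pi.smul_apply, hψx]; simp, by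
      rw [Pi.add_apply, Pi.smul_apply, hψy]; simp⟩
  have hint : fracPLaplaceIntegrand s p u φ =
      fracPLaplaceIntegrand s p u (φ - a • u - κ) + a • energyDensity s p u := by
    rw [← fracPLaplaceIntegrand_self hp, ← fracPLaplaceIntegrand_smul, ← fracPLaplaceIntegrand_add]
    funext z
    simp only [fracPLaplaceIntegrand, hκ, Pi.add_apply, Pi.sub_apply, Pi.smul_apply, smul_eq_mul]
    ring
  rw [hint]
  simp only [Pi.add_apply, Pi.smul_apply, smul_eq_mul]
  rw [integral_add (integrable_fracPLaplaceIntegrand hp hu hψ)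
    ((integrable_energyDensity hu).const_mul a), hzero, integral_const_mul, ha]
  ring

lemma isNonconstant_of_weaklySolves (hc : c ≠ 0) (hφ : φ ∈ spaceW N s p)
    (hne : φ x₀ ≠ φ y₀) (h : WeaklySolves (spaceW N s p) s p u c x₀ y₀) : IsNonconstant u := by
  rintro ⟨k, hk⟩
  have h2 := (h φ hφ).2
  simp [fracPLaplaceIntegrand, hk, Jp, hc, sub_eq_zero, hne] at h2

/-- For a competitor v, the function v - u vanishes at both points, so the linear term of the
tangent inequality disappears. Equal energies force v - u to be constant, hence zero by its value at
x₀. -/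
lemma isUniqueMinimizer_of_weaklySolves (hp : 1 < p) (hu : u ∈ spaceW N s p)
    (h : WeaklySolves (spaceW N s p) s p u c x₀ y₀) :
    IsUniqueMinimizer (slobodeckiiPow s p) (admissible s p x₀ y₀ (u x₀) (u y₀)) u := by
  have hL : ∀ v ∈ admissible s p x₀ y₀ (u x₀) (u y₀),
      ∫ z, fracPLaplaceIntegrand s p u (v - u) z = 0 := fun v hv => by
    rw [(h (v - u) (sub_mem_spaceW (by linarith) hv.1 hu)).2]
    simp [hv.2.1, hv.2.2]
  have hmem : u ∈ admissible s p x₀ y₀ (u x₀) (u y₀) := ⟨hu, rfl, rfl⟩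
  refine ⟨⟨hmem, fun v hv => ?_⟩, fun v ⟨hv, hvmin⟩ => ?_⟩
  · have := integral_energyDensity_tangent_le hp hu hv.1
    rw [hL v hv, mul_zero, add_zero] at this
    exact (slobodeckiiPow_le_iff hu hv.1).2 this
  · have h1 := (slobodeckiiPow_le_iff hv.1 hu).1 (hvmin hmem)
    funext x
    have := sub_eq_sub_of_tangent_eq hp hu hv.1 (by rw [hL v hv]; linarith) x x₀
    rw [hv.2.1] at this
    linarith

end FirstVariation

end FractionalMorrey

namespace FractionalMorrey

variable {N : ℕ} {s p : ℝ} {φ : EuclideanSpace ℝ (Fin N) → ℝ}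

/-! ### Test functions belong to 𝒲 -/

section TestFunctions

/-- In polar coordinates the integrand is at most a multiple of r^(p-sp-1) near 0, integrable as s <
1, and of r^(-1-sp) at infinity, integrable as sp > 0. -/
lemma integrable_min_rpow_div_rpow (hN : 1 ≤ N) (hs0 : 0 < s) (hs1 : s < 1) (hp : 1 < p)
    {L M : ℝ} (hL : 0 ≤ L) (hM : 0 ≤ M) :
    Integrable fun h : EuclideanSpace ℝ (Fin N) =>
      (min (L * ‖h‖) M) ^ p / ‖h‖ ^ ((N : ℝ) + s * p) := by
  have : Nonempty (Fin N) := ⟨⟨0, hN⟩⟩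
  have hps : 0 < p - s * p := by nlinarith
  have hsp : 0 < s * p := by positivity
  rw [integrable_fun_norm_addHaar volume (f := fun r : ℝ => (min (L * r) M) ^ p / r ^ ((N : ℝ) + s * p)),
    finrank_euclideanSpace_fin]
  have hmeas : AEStronglyMeasurable
      (fun r : ℝ => r ^ (N - 1) • ((min (L * r) M) ^ p / r ^ ((N : ℝ) + s * p))) := by
    have : Measurable
        fun r : ℝ => r ^ (N - 1) • ((min (L * r) M) ^ p / r ^ ((N : ℝ) + s * p)) := by
      fun_prop
    exact this.aestronglyMeasurable
  have hpow : ∀ r : ℝ, 0 < r → r ^ (N - 1) / r ^ ((N : ℝ) + s * p) = r ^ (-1 - s * p) := by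
    intro r hr
    rw [← Real.rpow_natCast, ← Real.rpow_sub hr, Nat.cast_sub hN]
    congr 1
    push_cast
    ring
  rw [← Set.Ioc_union_Ioi_eq_Ioi (zero_le_one' ℝ)]
  refine IntegrableOn.union ?_ ?_
  · have hi : IntegrableOn (fun r : ℝ => L ^ p * r ^ (p - s * p - 1)) (Set.Ioc 0 1) := by
      refine Integrable.const_mul ?_ _
      rw [← IntegrableOn, ← intervalIntegrable_iff_integrableOn_Ioc_of_le zero_le_one]
      exact intervalIntegral.intervalIntegrable_rpow' (by linarith)
    refine Integrable.mono' hi hmeas.restrict ?_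
    refine (ae_restrict_iff' measurableSet_Ioc).2 (ae_of_all _ fun r hr => ?_)
    have hr0 : 0 < r := hr.1
    have h0 : 0 ≤ min (L * r) M := le_min (by positivity) hM
    rw [smul_eq_mul, Real.norm_of_nonneg (by positivity), mul_div_left_comm, hpow r hr0]
    calc _ ≤ (L * r) ^ p * r ^ (-1 - s * p) := by
          gcongr
          exact min_le_left _ _
      _ = L ^ p * r ^ (p - s * p - 1) := by
          rw [Real.mul_rpow hL hr0.le, mul_assoc, ← Real.rpow_add hr0]
          ring_nf
  · have hi : IntegrableOn (fun r : ℝ => M ^ p * r ^ (-1 - s * p)) (Set.Ioi 1) :=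
      (integrableOn_Ioi_rpow_of_lt (by linarith) one_pos).const_mul _
    refine Integrable.mono' hi hmeas.restrict ?_
    refine (ae_restrict_iff' measurableSet_Ioi).2 (ae_of_all _ fun r hr => ?_)
    have hr0 : 0 < r := one_pos.trans hr
    have h0 : 0 ≤ min (L * r) M := le_min (by positivity) hM
    rw [smul_eq_mul, Real.norm_of_nonneg (by positivity), mul_div_left_comm, hpow r hr0]
    gcongr
    exact min_le_right _ _

lemma exists_bounds_of_mem_testFunctions (hφ : φ ∈ testFunctions N) :
    ∃ L M : ℝ, 0 ≤ L ∧ 0 ≤ M ∧ (∀ x y, |φ x - φ y| ≤ L * ‖x - y‖) ∧ ∀ x y, |φ x - φ y| ≤ M := by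
  obtain ⟨L, hL⟩ := hφ.1.lipschitzWith_of_hasCompactSupport hφ.2 (by simp)
  obtain ⟨M, hM⟩ := hφ.2.exists_bound_of_continuous hφ.1.continuous
  refine ⟨L, 2 * M, L.2, by linarith [(norm_nonneg _).trans (hM 0)], fun x y => ?_, fun x y => ?_⟩
  · simpa [dist_eq_norm, Real.norm_eq_abs] using hL.dist_le_mul x y
  · have h1 := hM x
    have h2 := hM y
    rw [Real.norm_eq_abs] at h1 h2
    linarith [abs_sub (φ x) (φ y)]

lemma holderSeminorm_lt_top_of_mem_testFunctions {α : ℝ} (hα0 : 0 ≤ α) (hα1 : α ≤ 1)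
    (hφ : φ ∈ testFunctions N) : holderSeminorm α φ < ⊤ := by
  obtain ⟨L, M, hL, hM, h1, h2⟩ := exists_bounds_of_mem_testFunctions hφ
  refine lt_of_le_of_lt ((holderSeminorm_le_iff (c := ENNReal.ofReal (L + M)) _ _).2
    fun x y hxy => ENNReal.ofReal_le_ofReal ?_) ENNReal.ofReal_lt_top
  have hr : 0 < ‖x - y‖ := norm_pos_iff.2 (sub_ne_zero.2 hxy)
  rw [div_le_iff₀ (Real.rpow_pos_of_pos hr α)]
  rcases le_total ‖x - y‖ 1 with h | h
  · calc |φ x - φ y| ≤ L * ‖x - y‖ ^ (1 : ℝ) := by rw [Real.rpow_one]; exact h1 x y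
      _ ≤ (L + M) * ‖x - y‖ ^ α := by
        gcongr ?_ * ?_
        · linarith
        · exact Real.rpow_le_rpow_of_exponent_ge hr h hα1
  · calc |φ x - φ y| ≤ M * 1 := by rw [mul_one]; exact h2 x y
      _ ≤ (L + M) * ‖x - y‖ ^ α := by
        gcongr ?_ * ?_
        · linarith
        · exact Real.one_le_rpow h hα0

/-- The integrand vanishes unless one variable lies in the support. Integrating out the other, by
translation invariance, leaves the measure of the support times a finite radial integral. -/
lemma slobodeckiiPow_lt_top_of_mem_testFunctions (hN : 1 ≤ N) (hs0 : 0 < s) (hs1 : s < 1)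
    (hp : 1 < p) (hφ : φ ∈ testFunctions N) : slobodeckiiPow s p φ < ⊤ := by
  obtain ⟨L, M, hL, hM, h1, h2⟩ := exists_bounds_of_mem_testFunctions hφ
  set g : EuclideanSpace ℝ (Fin N) → ℝ := fun h =>
    (min (L * ‖h‖) M) ^ p / ‖h‖ ^ ((N : ℝ) + s * p) with hg
  set K := tsupport φ with hK
  have hKm : MeasurableSet K := (isClosed_tsupport φ).measurableSet
  set G : ℝ≥0∞ := ∫⁻ h, ENNReal.ofReal (g h) with hG
  have hGfin : G < ⊤ := (integrable_min_rpow_div_rpow hN hs0 hs1 hp hL hM).lintegral_lt_top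
  have hgm : Measurable fun h => ENNReal.ofReal (g h) := by
    simp only [hg]; fun_prop
  have hG1 : ∀ x, ∫⁻ y, ENNReal.ofReal (g (x - y)) = G := fun x =>
    lintegral_sub_left_eq_self (fun h => ENNReal.ofReal (g h)) x
  have hG2 : ∀ y, ∫⁻ x, ENNReal.ofReal (g (x - y)) = G := fun y =>
    lintegral_sub_right_eq_self (fun h => ENNReal.ofReal (g h)) y
  have hgm2 : Measurable fun z : EuclideanSpace ℝ (Fin N) × EuclideanSpace ℝ (Fin N) =>
      ENNReal.ofReal (g (z.1 - z.2)) := hgm.comp (measurable_fst.sub measurable_snd)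
  have hind : Measurable (K.indicator fun _ => (1 : ℝ≥0∞)) := measurable_const.indicator hKm
  have hA : Measurable fun z : EuclideanSpace ℝ (Fin N) × EuclideanSpace ℝ (Fin N) =>
      K.indicator (fun _ => (1 : ℝ≥0∞)) z.1 * ENNReal.ofReal (g (z.1 - z.2)) :=
    (hind.comp measurable_fst).mul hgm2
  have hB : Measurable fun z : EuclideanSpace ℝ (Fin N) × EuclideanSpace ℝ (Fin N) =>
      K.indicator (fun _ => (1 : ℝ≥0∞)) z.2 * ENNReal.ofReal (g (z.1 - z.2)) :=
    (hind.comp measurable_snd).mul hgm2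
  have hKfin : volume K < ⊤ := hφ.2.isCompact.measure_lt_top
  calc slobodeckiiPow s p φ
      ≤ ∫⁻ z : EuclideanSpace ℝ (Fin N) × EuclideanSpace ℝ (Fin N),
          (K.indicator (fun _ => (1 : ℝ≥0∞)) z.1 * ENNReal.ofReal (g (z.1 - z.2)) +
          K.indicator (fun _ => (1 : ℝ≥0∞)) z.2 * ENNReal.ofReal (g (z.1 - z.2))) := by
        rw [slobodeckiiPow_eq]
        refine lintegral_mono fun z => ?_
        have hle : ENNReal.ofReal (energyDensity s p φ z) ≤ ENNReal.ofReal (g (z.1 - z.2)) := by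
          refine ENNReal.ofReal_le_ofReal ?_
          simp only [energyDensity, hg]
          gcongr
          exact le_min (h1 _ _) (h2 _ _)
        by_cases hz1 : z.1 ∈ K
        · simpa [hz1] using hle.trans le_self_add
        by_cases hz2 : z.2 ∈ K
        · simpa [hz1, hz2] using hle
        · have e1 : φ z.1 = 0 := image_eq_zero_of_notMem_tsupport hz1
          have e2 : φ z.2 = 0 := image_eq_zero_of_notMem_tsupport hz2
          simp [energyDensity, e1, e2, Real.zero_rpow (by linarith : p ≠ 0)]
    _ = volume K * G + volume K * G := by
        rw [lintegral_add_left hA]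
        congr 1
        · rw [Measure.volume_eq_prod, lintegral_prod _ hA.aemeasurable]
          have e : ∀ x, ∫⁻ y, K.indicator (fun _ => (1 : ℝ≥0∞)) x * ENNReal.ofReal (g (x - y)) =
              K.indicator (fun _ => (1 : ℝ≥0∞)) x * G := fun x => by
            rw [lintegral_const_mul (f := fun y => ENNReal.ofReal (g (x - y))) _
              (hgm.comp (measurable_const.sub measurable_id)), hG1]
          rw [lintegral_congr e, lintegral_mul_const _ hind, lintegral_indicator_const hKm, one_mul]
        · rw [Measure.volume_eq_prod, lintegral_prod_symm _ hB.aemeasurable]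
          have e : ∀ y, ∫⁻ x, K.indicator (fun _ => (1 : ℝ≥0∞)) y * ENNReal.ofReal (g (x - y)) =
              K.indicator (fun _ => (1 : ℝ≥0∞)) y * G := fun y => by
            rw [lintegral_const_mul (f := fun x => ENNReal.ofReal (g (x - y))) _
              (hgm.comp (measurable_id.sub measurable_const)), hG2]
          rw [lintegral_congr e, lintegral_mul_const _ hind, lintegral_indicator_const hKm, one_mul]
    _ < ⊤ := by
        have := ENNReal.mul_lt_top hKfin hGfin
        exact ENNReal.add_lt_top.2 ⟨this, this⟩

lemma morreyExponent_pos (hp : 1 < p) (hsp : (N : ℝ) < s * p) : 0 < morreyExponent N s p := by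
  rw [morreyExponent, sub_pos, div_lt_iff₀ (by linarith)]
  exact hsp

lemma morreyExponent_mul (hp : 1 < p) : morreyExponent N s p * p = s * p - N := by
  have : p ≠ 0 := by linarith
  rw [morreyExponent]
  field_simp

lemma testFunctions_subset_spaceW (hN : 1 ≤ N) (hs0 : 0 < s) (hs1 : s < 1) (hp : 1 < p)
    (hsp : (N : ℝ) < s * p) : testFunctions N ⊆ spaceW N s p := fun φ hφ =>
  ⟨hφ.1.continuous, holderSeminorm_lt_top_of_mem_testFunctions (morreyExponent_pos hp hsp).le
    (by have : 0 ≤ (N : ℝ) / p := by positivity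
        rw [morreyExponent]; linarith) hφ,
    slobodeckiiPow_lt_top_of_mem_testFunctions hN hs0 hs1 hp hφ⟩

lemma exists_mem_testFunctions_ne {x₀ y₀ : EuclideanSpace ℝ (Fin N)} (hxy : x₀ ≠ y₀) :
    ∃ φ ∈ testFunctions N, φ x₀ ≠ φ y₀ := by
  have hd : 0 < dist y₀ x₀ := dist_pos.2 hxy.symm
  let b : ContDiffBump x₀ := ⟨dist y₀ x₀ / 2, dist y₀ x₀, by positivity, by linarith⟩
  refine ⟨b, ⟨b.contDiff, b.hasCompactSupport⟩, ?_⟩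
  rw [b.one_of_mem_closedBall (Metric.mem_closedBall_self b.rIn_pos.le),
    b.zero_of_le_dist le_rfl]
  exact one_ne_zero

end TestFunctions

/-! ### Scaling under similarities -/

section Similarity

/-- Precomposition with `z ↦ l (r z) + c` for a linear isometry `r` and `l > 0`. -/
noncomputable def compSimilarity (u : EuclideanSpace ℝ (Fin N) → ℝ)
    (r : EuclideanSpace ℝ (Fin N) ≃ₗᵢ[ℝ] EuclideanSpace ℝ (Fin N)) (l : ℝ)
    (c : EuclideanSpace ℝ (Fin N)) : EuclideanSpace ℝ (Fin N) → ℝ :=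
  fun x => u (l • r x + c)

variable {u : EuclideanSpace ℝ (Fin N) → ℝ}
  (r : EuclideanSpace ℝ (Fin N) ≃ₗᵢ[ℝ] EuclideanSpace ℝ (Fin N)) {l : ℝ}
  (c : EuclideanSpace ℝ (Fin N))

lemma norm_similarity_sub (hl : 0 < l) (x y : EuclideanSpace ℝ (Fin N)) :
    ‖(l • r x + c) - (l • r y + c)‖ = l * ‖x - y‖ := by
  rw [add_sub_add_right_eq_sub, ← smul_sub, ← map_sub, norm_smul, Real.norm_of_nonneg hl.le,
    r.norm_map]

lemma holderRatio_compSimilarity (α : ℝ) (hl : 0 < l) (x y : EuclideanSpace ℝ (Fin N)) :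
    holderRatio α (compSimilarity u r l c) x y =
      ENNReal.ofReal (l ^ α) * holderRatio α u (l • r x + c) (l • r y + c) := by
  unfold holderRatio compSimilarity
  rw [← ENNReal.ofReal_mul (by positivity), norm_similarity_sub r c hl,
    Real.mul_rpow hl.le (norm_nonneg _)]
  have : 0 < l ^ α := by positivity
  congr 1
  field_simp

lemma holderSeminorm_compSimilarity_le (α : ℝ) (hl : 0 < l) :
    holderSeminorm α (compSimilarity u r l c) ≤ ENNReal.ofReal (l ^ α) * holderSeminorm α u :=
  (holderSeminorm_le_iff _ _).2 fun x y _ => by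
    rw [holderRatio_compSimilarity r c α hl]
    gcongr
    exact holderRatio_le_holderSeminorm _ _ _ _

/-- The kernel contributes l^(N+sp) and the change of variables on the product l^(-2N). The
resulting exponent sp - N equals αp, which matches the Hölder seminorm. -/
lemma slobodeckiiPow_compSimilarity (hu : Continuous u) (hl : 0 < l) :
    slobodeckiiPow s p (compSimilarity u r l c) =
      ENNReal.ofReal (l ^ (s * p - N)) * slobodeckiiPow s p u := by
  set F : EuclideanSpace ℝ (Fin N) × EuclideanSpace ℝ (Fin N) → ℝ≥0∞ := fun z =>
    ENNReal.ofReal (energyDensity s p u z) with hF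
  have hFm : Measurable F := (measurable_energyDensity hu).ennreal_ofReal
  have hlne : l ≠ 0 := hl.ne'
  have e1 : ∀ z, ENNReal.ofReal (energyDensity s p (compSimilarity u r l c) z) =
      ENNReal.ofReal (l ^ ((N : ℝ) + s * p)) * F (l • (Prod.map r r z) + (c, c)) := fun z => by
    simp only [hF]
    rw [← ENNReal.ofReal_mul (by positivity)]
    congr 1
    simp only [energyDensity, compSimilarity, Prod.fst_add, Prod.snd_add, Prod.smul_fst,
      Prod.smul_snd, Prod.map_fst, Prod.map_snd]
    rw [norm_similarity_sub r c hl, Real.mul_rpow hl.le (norm_nonneg _)]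
    have : 0 < l ^ ((N : ℝ) + s * p) := by positivity
    field_simp
  have hHaar : (volume : Measure (EuclideanSpace ℝ (Fin N) × EuclideanSpace ℝ (Fin N))
      ).IsAddHaarMeasure := by
    rw [Measure.volume_eq_prod]; infer_instance
  have hr : MeasurePreserving (Prod.map r r)
      (volume : Measure (EuclideanSpace ℝ (Fin N) × EuclideanSpace ℝ (Fin N))) volume :=
    r.measurePreserving.prod r.measurePreserving
  have hFc : Measurable fun z => F (z + (c, c)) := hFm.comp (measurable_add_const _)
  have e2 : ∫⁻ z, F (l • (Prod.map r r z) + (c, c)) =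
      ENNReal.ofReal ((l ^ (2 * N))⁻¹) * ∫⁻ z, F z := by
    rw [hr.lintegral_comp (f := fun z => F (l • z + (c, c)))
      (hFc.comp (measurable_const_smul l)),
      ← lintegral_map (f := fun z => F (z + (c, c))) hFc (measurable_const_smul l),
      Measure.map_addHaar_smul _ hlne, lintegral_smul_measure,
      lintegral_add_right_eq_self F (c, c), smul_eq_mul, Module.finrank_prod,
      finrank_euclideanSpace_fin, ← two_mul, abs_of_pos (by positivity)]
  rw [slobodeckiiPow_eq, lintegral_congr e1, lintegral_const_mul' _ _ ENNReal.ofReal_ne_top, e2,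
    ← mul_assoc, ← ENNReal.ofReal_mul (by positivity), slobodeckiiPow_eq]
  congr 2
  rw [← Real.rpow_natCast, ← Real.rpow_neg hl.le, ← Real.rpow_add hl]
  push_cast
  ring_nf

lemma continuous_compSimilarity (hu : Continuous u) : Continuous (compSimilarity u r l c) :=
  hu.comp ((r.continuous.const_smul l).add continuous_const)

lemma compSimilarity_mem_spaceW (hl : 0 < l) (hu : u ∈ spaceW N s p) :
    compSimilarity u r l c ∈ spaceW N s p :=
  ⟨continuous_compSimilarity r c hu.1,
    (holderSeminorm_compSimilarity_le r c _ hl).trans_lt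
      (ENNReal.mul_lt_top ENNReal.ofReal_lt_top hu.2.1),
    by rw [slobodeckiiPow_compSimilarity r c hu.1 hl]
       exact ENNReal.mul_lt_top ENNReal.ofReal_lt_top hu.2.2⟩

/-- The dilation factor is forced by the distances. Two vectors of equal norm are then exchanged by
reflection in the orthogonal complement of their difference, and a translation finishes. -/
lemma exists_similarity {x₀ y₀ a b : EuclideanSpace ℝ (Fin N)} (hxy : x₀ ≠ y₀) (hab : a ≠ b) :
    ∃ (r : EuclideanSpace ℝ (Fin N) ≃ₗᵢ[ℝ] EuclideanSpace ℝ (Fin N)) (l : ℝ)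
      (c : EuclideanSpace ℝ (Fin N)), 0 < l ∧ l • r x₀ + c = a ∧ l • r y₀ + c = b := by
  have hd : 0 < ‖x₀ - y₀‖ := norm_pos_iff.2 (sub_ne_zero.2 hxy)
  have hd' : 0 < ‖a - b‖ := norm_pos_iff.2 (sub_ne_zero.2 hab)
  set l := ‖a - b‖ / ‖x₀ - y₀‖ with hl
  have hl0 : 0 < l := by positivity
  have hnorm : ‖x₀ - y₀‖ = ‖l⁻¹ • (a - b)‖ := by
    rw [norm_smul, norm_inv, Real.norm_of_nonneg hl0.le, hl]
    field_simp
  refine ⟨(ℝ ∙ (x₀ - y₀ - l⁻¹ • (a - b)))ᗮ.reflection, l, _, hl0,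
    add_sub_cancel (l • (ℝ ∙ (x₀ - y₀ - l⁻¹ • (a - b)))ᗮ.reflection x₀) a, ?_⟩
  have h := Submodule.reflection_sub hnorm
  rw [map_sub, sub_eq_iff_eq_add] at h
  rw [h, smul_add, smul_inv_smul₀ hl0.ne']
  abel

end Similarity

end FractionalMorrey

namespace FractionalMorrey

variable {N : ℕ} {s p : ℝ}

/-! ### Approximation by test functions and Morrey's inequality on 𝒲 -/

section Density

open Filter Topology

variable {u v w : EuclideanSpace ℝ (Fin N) → ℝ}

/-- Truncation of `u` between `-w` and `w`. -/
def clamp (u w : EuclideanSpace ℝ (Fin N) → ℝ) : EuclideanSpace ℝ (Fin N) → ℝ :=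
  fun x => max (min (u x) (w x)) (-w x)

lemma continuous_clamp (hu : Continuous u) (hw : Continuous w) : Continuous (clamp u w) :=
  (hu.min hw).max hw.neg

lemma hasCompactSupport_clamp (u : EuclideanSpace ℝ (Fin N) → ℝ) (hw : HasCompactSupport w) :
    HasCompactSupport (clamp u w) :=
  hw.mono fun x hx hwx => hx (by simp [clamp, hwx])

lemma clamp_apply_of_abs_le {x : EuclideanSpace ℝ (Fin N)} (h : |u x| ≤ w x) :
    clamp u w x = u x := by
  rw [abs_le] at h
  rw [clamp, min_eq_left h.2, max_eq_left h.1]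

/-- Truncation does not increase the larger of the two differences, and the p-th power of a maximum
is at most the sum of the powers. The coefficient 1 before the energy of u is what prevents a loss
in the limit. -/
lemma slobodeckiiPow_clamp_le (hp : 0 ≤ p) (hu : Continuous u) :
    slobodeckiiPow s p (clamp u w) ≤ slobodeckiiPow s p u + slobodeckiiPow s p w := by
  simp only [slobodeckiiPow_eq]
  rw [← lintegral_add_left (measurable_energyDensity hu).ennreal_ofReal]
  refine lintegral_mono fun z => ?_
  rw [← ENNReal.ofReal_add (energyDensity_nonneg _ _ _ _) (energyDensity_nonneg _ _ _ _)]
  refine ENNReal.ofReal_le_ofReal ?_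
  simp only [energyDensity]
  rw [← add_div]
  gcongr
  have h := abs_clamp_sub_le (u z.1) (u z.2) (w z.1) (w z.2)
  have h1 : 0 ≤ |u z.1 - u z.2| ^ p := by positivity
  have h2 : 0 ≤ |w z.1 - w z.2| ^ p := by positivity
  refine (Real.rpow_le_rpow (abs_nonneg _) h hp).trans ?_
  rcases max_cases |u z.1 - u z.2| |w z.1 - w z.2| with ⟨e, -⟩ | ⟨e, -⟩ <;> rw [e] <;> linarith

/-- Jensen's inequality: integrate the tangent inequality at the mean m against ρ, so that the
linear term cancels. -/
lemma abs_integral_rpow_le {ρ f : EuclideanSpace ℝ (Fin N) → ℝ} (hp : 1 < p)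
    (hρ : Continuous ρ) (hρc : HasCompactSupport ρ) (hρ0 : ∀ t, 0 ≤ ρ t) (hρ1 : ∫ t, ρ t = 1)
    (hf : Continuous f) : |∫ t, ρ t * f t| ^ p ≤ ∫ t, ρ t * |f t| ^ p := by
  set m := ∫ t, ρ t * f t with hm
  have i0 : Integrable ρ := hρ.integrable_of_hasCompactSupport hρc
  have i1 : Integrable fun t => ρ t * f t :=
    (hρ.mul hf).integrable_of_hasCompactSupport hρc.mul_right
  have i2 : Integrable fun t => ρ t * |f t| ^ p :=
    (hρ.mul (hf.abs.rpow_const fun _ => Or.inr (by linarith))).integrable_of_hasCompactSupport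
      hρc.mul_right
  have i3 : Integrable fun t =>
      (|m| ^ p - p * Jp p m * m) * ρ t + p * Jp p m * (ρ t * f t) :=
    (i0.const_mul _).add (i1.const_mul _)
  have h := integral_mono i3 i2 fun t => by
    have := mul_le_mul_of_nonneg_left (tangent_le hp m (f t)) (hρ0 t)
    refine le_trans (le_of_eq ?_) this
    ring
  rw [integral_add (i0.const_mul _) (i1.const_mul _), integral_const_mul, integral_const_mul,
    hρ1, ← hm] at h
  linarith

/-- Jensen bounds the density at each z by an average of its diagonal translates; Tonelli and
translation invariance conclude. -/
lemma slobodeckiiPow_convolution_le {ρ φ : EuclideanSpace ℝ (Fin N) → ℝ} (hp : 1 < p)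
    (hρ : Continuous ρ) (hρc : HasCompactSupport ρ) (hρ0 : ∀ t, 0 ≤ ρ t) (hρ1 : ∫ t, ρ t = 1)
    (hv : Continuous v) (hφ : ∀ x, φ x = ∫ t, ρ t * v (x - t)) :
    slobodeckiiPow s p φ ≤ slobodeckiiPow s p v := by
  have hHaar : (volume : Measure (EuclideanSpace ℝ (Fin N) × EuclideanSpace ℝ (Fin N))
      ).IsAddHaarMeasure := by
    rw [Measure.volume_eq_prod]; infer_instance
  set F : EuclideanSpace ℝ (Fin N) × EuclideanSpace ℝ (Fin N) → ℝ≥0∞ := fun z =>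
    ENNReal.ofReal (energyDensity s p v z) with hF
  have hFm : Measurable F := (measurable_energyDensity hv).ennreal_ofReal
  have hle : ∀ z, ENNReal.ofReal (energyDensity s p φ z) ≤
      ∫⁻ t, ENNReal.ofReal (ρ t) * F (z - (t, t)) := fun z => by
    have hfc : Continuous fun t => v (z.1 - t) - v (z.2 - t) := by fun_prop
    have hi : Integrable fun t => ρ t * energyDensity s p v (z - (t, t)) := by
      refine Continuous.integrable_of_hasCompactSupport ?_ hρc.mul_right
      simp only [energyDensity, Prod.fst_sub, Prod.snd_sub, sub_sub_sub_cancel_right]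
      exact hρ.mul ((hfc.abs.rpow_const fun _ => Or.inr (by linarith)).div_const _)
    simp only [hF]
    simp_rw [← ENNReal.ofReal_mul (hρ0 _)]
    rw [← ofReal_integral_eq_lintegral_ofReal hi
      (ae_of_all _ fun t => mul_nonneg (hρ0 t) (energyDensity_nonneg _ _ _ _))]
    refine ENNReal.ofReal_le_ofReal ?_
    simp only [energyDensity, Prod.fst_sub, Prod.snd_sub, sub_sub_sub_cancel_right]
    simp_rw [← mul_div_assoc]
    rw [integral_div]
    gcongr
    have i : ∀ x, Integrable fun t => ρ t * v (x - t) := fun x =>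
      (hρ.mul (by fun_prop)).integrable_of_hasCompactSupport hρc.mul_right
    rw [hφ, hφ, ← integral_sub (i _) (i _)]
    simp_rw [← mul_sub]
    exact abs_integral_rpow_le hp hρ hρc hρ0 hρ1 hfc
  have hFt : ∀ t, ∫⁻ z, F (z - (t, t)) = ∫⁻ z, F z := fun t =>
    lintegral_sub_right_eq_self F (t, t)
  calc slobodeckiiPow s p φ ≤ ∫⁻ z, ∫⁻ t, ENNReal.ofReal (ρ t) * F (z - (t, t)) :=
        lintegral_mono hle
    _ = ∫⁻ t, ∫⁻ z, ENNReal.ofReal (ρ t) * F (z - (t, t)) := by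
        refine lintegral_lintegral_swap (Measurable.aemeasurable ?_)
        exact (hρ.measurable.comp measurable_snd).ennreal_ofReal.mul (hFm.comp (by fun_prop))
    _ = ∫⁻ t, ENNReal.ofReal (ρ t) * slobodeckiiPow s p v := by
        refine lintegral_congr fun t => ?_
        rw [lintegral_const_mul' _ _ ENNReal.ofReal_ne_top, hFt, slobodeckiiPow_eq]
    _ = slobodeckiiPow s p v := by
        rw [lintegral_mul_const _ hρ.measurable.ennreal_ofReal,
          ← ofReal_integral_eq_lintegral_ofReal (hρ.integrable_of_hasCompactSupport hρc)
            (ae_of_all _ hρ0), hρ1, ENNReal.ofReal_one, one_mul]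

lemma exists_mem_testFunctions_near (hp : 1 < p) (hv : Continuous v) (hvc : HasCompactSupport v)
    {ε : ℝ} (hε : 0 < ε) :
    ∃ φ ∈ testFunctions N, (∀ x, |φ x - v x| ≤ ε) ∧ slobodeckiiPow s p φ ≤ slobodeckiiPow s p v := by
  obtain ⟨δ, hδ, hvδ⟩ := Metric.uniformContinuous_iff.1
    (hvc.uniformContinuous_of_continuous hv) ε hε
  obtain ⟨b, hb⟩ : ∃ b : ContDiffBump (0 : EuclideanSpace ℝ (Fin N)), b.rOut = δ :=
    ⟨⟨δ / 2, δ, half_pos hδ, half_lt_self hδ⟩, rfl⟩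
  have hρc : HasCompactSupport (b.normed volume) := b.hasCompactSupport_normed
  refine ⟨convolution (b.normed volume) v (ContinuousLinearMap.lsmul ℝ ℝ) volume,
    ⟨hρc.contDiff_convolution_left _ b.contDiff_normed hv.locallyIntegrable,
      hρc.convolution _ hvc⟩, fun x => ?_, ?_⟩
  · rw [← Real.dist_eq]
    exact b.dist_normed_convolution_le hv.aestronglyMeasurable fun y hy => (hvδ (hb ▸ hy)).le
  · exact slobodeckiiPow_convolution_le hp b.continuous_normed hρc b.nonneg_normed
      b.integral_normed hv fun x => by
        simp only [convolution_def, ContinuousLinearMap.lsmul_apply, smul_eq_mul]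

/-- Compactly supported functions blowing up at every point whose energy tends to zero; these
exist because `N < s p`. -/
lemma exists_cutoff (hN : 1 ≤ N) (hs0 : 0 < s) (hs1 : s < 1) (hp : 1 < p)
    (hsp : (N : ℝ) < s * p) :
    ∃ (w : ℕ → EuclideanSpace ℝ (Fin N) → ℝ) (e : ℕ → ℝ), Tendsto e atTop (𝓝 0) ∧
      (∀ n, Continuous (w n)) ∧ (∀ n, HasCompactSupport (w n)) ∧
      (∀ n, slobodeckiiPow s p (w n) ≤ ENNReal.ofReal (e n)) ∧
      ∀ x, Tendsto (fun n => w n x) atTop atTop := by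
  let b : ContDiffBump (0 : EuclideanSpace ℝ (Fin N)) := ⟨1, 2, one_pos, one_lt_two⟩
  have hb := slobodeckiiPow_lt_top_of_mem_testFunctions hN hs0 hs1 hp
    (φ := b) ⟨b.contDiff, b.hasCompactSupport⟩
  set A := (slobodeckiiPow s p b).toReal with hA
  have hα := morreyExponent_pos hp hsp
  set α := morreyExponent N s p with hαdef
  have hαp : 0 < α * p := by positivity
  have hR : ∀ n : ℕ, (0 : ℝ) < n + 1 := fun n => by positivity
  have hRtop : Tendsto (fun n : ℕ => (n : ℝ) + 1) atTop atTop :=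
    tendsto_atTop_add_const_right _ _ tendsto_natCast_atTop_atTop
  let e : EuclideanSpace ℝ (Fin N) ≃ₗᵢ[ℝ] EuclideanSpace ℝ (Fin N) := LinearIsometryEquiv.refl ℝ _
  have hval : ∀ (n : ℕ) x, compSimilarity b e ((n : ℝ) + 1)⁻¹ 0 x = b (((n : ℝ) + 1)⁻¹ • x) :=
    fun n x => by simp [compSimilarity, e]
  -- Spreading a bump to radius R = n + 1 costs energy R^(-αp). The amplitude R^(α/2) returns only
  -- half of that exponent, so the energy still decays while the values blow up.
  refine ⟨fun n => ((n : ℝ) + 1) ^ (α / 2) • compSimilarity b e ((n : ℝ) + 1)⁻¹ 0,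
    fun n => ((n : ℝ) + 1) ^ (-(α * p / 2)) * A, ?_, fun n => ?_, fun n => ?_, fun n => ?_,
    fun x => ?_⟩
  · simpa using ((tendsto_rpow_neg_atTop (half_pos hαp)).comp hRtop).mul_const A
  · exact (continuous_compSimilarity _ _ b.continuous).const_smul _
  · have : HasCompactSupport (compSimilarity b e ((n : ℝ) + 1)⁻¹ 0) := by
      rw [funext (hval n)]
      exact b.hasCompactSupport.comp_smul (inv_ne_zero (hR n).ne')
    exact this.smul_left
  · rw [slobodeckiiPow_smul, slobodeckiiPow_compSimilarity _ _ b.continuous (inv_pos.2 (hR n)),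
      ENNReal.ofReal_mul (by have := hR n; positivity), hA, ENNReal.ofReal_toReal hb.ne,
      ← mul_assoc, ← ENNReal.ofReal_mul (by positivity),
      abs_of_nonneg (by have := hR n; positivity), ← Real.rpow_mul (hR n).le,
      Real.inv_rpow (hR n).le, ← Real.rpow_neg (hR n).le, ← Real.rpow_add (hR n),
      ← morreyExponent_mul hp, ← hαdef]
    refine le_of_eq ?_
    congr 3
    ring
  · have h1 : Tendsto (fun n : ℕ => ((n : ℝ) + 1) ^ (α / 2)) atTop atTop :=
      (tendsto_rpow_atTop (half_pos hα)).comp hRtop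
    refine h1.congr' ?_
    filter_upwards [hRtop.eventually_ge_atTop ‖x‖] with n hn
    have : ((n : ℝ) + 1)⁻¹ • x ∈ Metric.closedBall (0 : EuclideanSpace ℝ (Fin N)) b.rIn := by
      rw [mem_closedBall_zero_iff, norm_smul, norm_inv, Real.norm_of_nonneg (hR n).le,
        inv_mul_le_iff₀ (hR n)]
      simpa [b] using hn
    rw [Pi.smul_apply, hval, b.one_of_mem_closedBall this, smul_eq_mul, mul_one]

/-- Truncate u by the cutoffs, then mollify with uniform error 1/(n+1). At a fixed point the
truncation is eventually inactive. -/
lemma exists_seq_testFunctions (hN : 1 ≤ N) (hs0 : 0 < s) (hs1 : s < 1) (hp : 1 < p)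
    (hsp : (N : ℝ) < s * p) (hu : u ∈ spaceW N s p) :
    ∃ (φ : ℕ → EuclideanSpace ℝ (Fin N) → ℝ) (e : ℕ → ℝ), Tendsto e atTop (𝓝 0) ∧
      (∀ n, φ n ∈ testFunctions N) ∧
      (∀ n, slobodeckiiPow s p (φ n) ≤ slobodeckiiPow s p u + ENNReal.ofReal (e n)) ∧
      ∀ x, Tendsto (fun n => φ n x) atTop (𝓝 (u x)) := by
  obtain ⟨w, e, he, hwc, hws, hwe, hwt⟩ := exists_cutoff hN hs0 hs1 hp hsp
  choose φ hφ hnear hE using fun n : ℕ => exists_mem_testFunctions_near (s := s) hp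
    (continuous_clamp hu.1 (hwc n)) (hasCompactSupport_clamp u (hws n))
    (Nat.one_div_pos_of_nat (α := ℝ) (n := n))
  refine ⟨φ, e, he, hφ, fun n => (hE n).trans ((slobodeckiiPow_clamp_le (by linarith) hu.1).trans
    (add_le_add_right (hwe n) _)), fun x => ?_⟩
  rw [tendsto_iff_norm_sub_tendsto_zero]
  refine squeeze_zero' (Eventually.of_forall fun n => norm_nonneg _) ?_
    tendsto_one_div_add_atTop_nhds_zero_nat
  filter_upwards [(hwt x).eventually_ge_atTop |u x|] with n hn
  have := hnear n x
  rwa [clamp_apply_of_abs_le hn] at this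

lemma mul_holderSeminorm_rpow_le {α : ℝ} {A B : ℝ≥0∞} (hp : 0 < p) (hB : B ≠ ⊤)
    (h : ∀ x y, x ≠ y → A * holderRatio α u x y ^ p ≤ B) : A * holderSeminorm α u ^ p ≤ B := by
  rcases eq_or_ne A 0 with rfl | hA
  · simp
  have hle : holderSeminorm α u ≤ (B / A) ^ p⁻¹ :=
    (holderSeminorm_le_iff _ _).2 fun x y hxy => by
      rw [ENNReal.le_rpow_inv_iff hp, ENNReal.le_div_iff_mul_le (Or.inl hA) (Or.inr hB), mul_comm]
      exact h x y hxy
  rw [ENNReal.le_rpow_inv_iff hp, ENNReal.le_div_iff_mul_le (Or.inl hA) (Or.inr hB),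
    mul_comm] at hle
  exact hle

lemma morreyConst_mul_le_of_mem_testFunctions {φ : EuclideanSpace ℝ (Fin N) → ℝ} (hp : 1 < p)
    (hφ : φ ∈ testFunctions N) (hH : holderSeminorm (morreyExponent N s p) φ ≠ ⊤) :
    morreyConst N s p * holderSeminorm (morreyExponent N s p) φ ^ p ≤ slobodeckiiPow s p φ := by
  set H := holderSeminorm (morreyExponent N s p) φ with hHdef
  have hp0 : 0 < p := by linarith
  rcases eq_or_ne H 0 with h0 | h0
  · simp [h0, hp0]
  have hpos : 0 < H.toReal := ENNReal.toReal_pos h0 hH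
  have hinv : ENNReal.ofReal |H.toReal⁻¹| = H⁻¹ := by
    rw [abs_of_pos (inv_pos.2 hpos), ENNReal.ofReal_inv_of_pos hpos, ENNReal.ofReal_toReal hH]
  have hle : morreyConst N s p ≤ slobodeckiiPow s p (H.toReal⁻¹ • φ) := by
    refine iInf₂_le _ ⟨⟨contDiff_const.smul hφ.1, hφ.2.smul_left⟩, ?_⟩
    rw [holderSeminorm_smul, hinv, ← hHdef, ENNReal.inv_mul_cancel h0 hH]
  rw [slobodeckiiPow_smul, ← ENNReal.ofReal_rpow_of_nonneg (abs_nonneg _) hp0.le, hinv] at hle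
  calc _ ≤ H⁻¹ ^ p * slobodeckiiPow s p φ * H ^ p := by gcongr
    _ = (H⁻¹ * H) ^ p * slobodeckiiPow s p φ := by
      rw [ENNReal.mul_rpow_of_nonneg _ _ hp0.le]; ring
    _ = slobodeckiiPow s p φ := by
      rw [ENNReal.inv_mul_cancel h0 hH, ENNReal.one_rpow, one_mul]

/-- For one fixed pair, the inequality for the approximants passes to the limit by pointwise
convergence alone; the supremum over pairs is taken afterwards. -/
lemma morreyConst_mul_le (hN : 1 ≤ N) (hs0 : 0 < s) (hs1 : s < 1) (hp : 1 < p)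
    (hsp : (N : ℝ) < s * p) (hu : u ∈ spaceW N s p) :
    morreyConst N s p * holderSeminorm (morreyExponent N s p) u ^ p ≤ slobodeckiiPow s p u := by
  have hp0 : 0 < p := by linarith
  obtain ⟨φ, e, he, hφ, hE, hlim⟩ := exists_seq_testFunctions hN hs0 hs1 hp hsp hu
  refine mul_holderSeminorm_rpow_le hp0 hu.2.2.ne fun x y hxy => ?_
  -- Since `morreyConst` is not known to be finite here, multiplication by it is continuous only
  -- away from 0.
  rcases eq_or_ne (holderRatio (morreyExponent N s p) u x y) 0 with h0 | h0
  · simp [h0, hp0]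
  have h1 : Tendsto (fun n => holderRatio (morreyExponent N s p) (φ n) x y) atTop
      (𝓝 (holderRatio (morreyExponent N s p) u x y)) :=
    ENNReal.tendsto_ofReal ((((hlim x).sub (hlim y)).abs).div_const _)
  have h2 := ENNReal.Tendsto.const_mul (a := morreyConst N s p)
    ((ENNReal.continuous_rpow_const (y := p)).tendsto _ |>.comp h1)
    (Or.inl (by simp [h0, hp0, hp0.not_gt]))
  have h3 : Tendsto (fun n => slobodeckiiPow s p u + ENNReal.ofReal (e n)) atTop
      (𝓝 (slobodeckiiPow s p u)) := by
    simpa using tendsto_const_nhds.add (ENNReal.tendsto_ofReal he)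
  refine le_of_tendsto_of_tendsto' h2 h3 fun n => ?_
  refine le_trans ?_ ((morreyConst_mul_le_of_mem_testFunctions hp (hφ n)
    (testFunctions_subset_spaceW hN hs0 hs1 hp hsp (hφ n)).2.1.ne).trans (hE n))
  simp only [Function.comp_apply]
  gcongr
  exact holderRatio_le_holderSeminorm _ _ _ _

end Density

/-! ### From smooth test functions to all of 𝒲 in the weak equation -/

section Extension

open Filter Topology

variable {u φ : EuclideanSpace ℝ (Fin N) → ℝ} {x₀ y₀ : EuclideanSpace ℝ (Fin N)} {c : ℝ}

/-- The nonnegative gap in Young's inequality `p J_p(a) b ≤ (p - 1) |a|^p + |b|^p`. -/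
noncomputable def youngGap (s p : ℝ) (u φ : EuclideanSpace ℝ (Fin N) → ℝ)
    (z : EuclideanSpace ℝ (Fin N) × EuclideanSpace ℝ (Fin N)) : ℝ :=
  (p - 1) * energyDensity s p u z + energyDensity s p φ z - p * fracPLaplaceIntegrand s p u φ z

lemma youngGap_nonneg (hp : 1 < p) (u φ : EuclideanSpace ℝ (Fin N) → ℝ)
    (z : EuclideanSpace ℝ (Fin N) × EuclideanSpace ℝ (Fin N)) : 0 ≤ youngGap s p u φ z := by
  have h := energyDensity_tangent_le (s := s) hp u φ z
  have h' : fracPLaplaceIntegrand s p u (φ - u) z =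
      fracPLaplaceIntegrand s p u φ z - energyDensity s p u z := by
    rw [← fracPLaplaceIntegrand_self hp]
    simp only [fracPLaplaceIntegrand, Pi.sub_apply]
    ring
  rw [h'] at h
  unfold youngGap
  linarith

lemma integrable_youngGap (hp : 1 < p) (hu : u ∈ spaceW N s p) (hφ : φ ∈ spaceW N s p) :
    Integrable (youngGap s p u φ) :=
  (((integrable_energyDensity hu).const_mul (p - 1)).add (integrable_energyDensity hφ)).sub
    ((integrable_fracPLaplaceIntegrand hp hu hφ).const_mul p)

lemma integral_youngGap (hp : 1 < p) (hu : u ∈ spaceW N s p) (hφ : φ ∈ spaceW N s p) :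
    ∫ z, youngGap s p u φ z = (p - 1) * (∫ z, energyDensity s p u z) +
      (∫ z, energyDensity s p φ z) - p * ∫ z, fracPLaplaceIntegrand s p u φ z := by
  have i1 := (integrable_energyDensity hu).const_mul (p - 1)
  have i2 := integrable_energyDensity hφ
  have i3 : Integrable fun z => (p - 1) * energyDensity s p u z + energyDensity s p φ z :=
    i1.add i2
  unfold youngGap
  rw [integral_sub i3 ((integrable_fracPLaplaceIntegrand hp hu hφ).const_mul p),
    integral_add i1 i2, integral_const_mul, integral_const_mul]

lemma lintegral_youngGap (hp : 1 < p) (hu : u ∈ spaceW N s p) (hφ : φ ∈ spaceW N s p) :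
    ∫⁻ z, ENNReal.ofReal (youngGap s p u φ z) = ENNReal.ofReal (∫ z, youngGap s p u φ z) :=
  (ofReal_integral_eq_lintegral_ofReal (integrable_youngGap hp hu hφ)
    (ae_of_all _ (youngGap_nonneg hp u φ))).symm

lemma tendsto_youngGap (hp : 1 < p) {φs : ℕ → EuclideanSpace ℝ (Fin N) → ℝ}
    (h : ∀ x, Tendsto (fun n => φs n x) atTop (𝓝 (φ x)))
    (z : EuclideanSpace ℝ (Fin N) × EuclideanSpace ℝ (Fin N)) :
    Tendsto (fun n => youngGap s p u (φs n) z) atTop (𝓝 (youngGap s p u φ z)) := by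
  have hd := (h z.1).sub (h z.2)
  have h1 : Tendsto (fun n => energyDensity s p (φs n) z) atTop (𝓝 (energyDensity s p φ z)) :=
    (hd.abs.rpow_const (Or.inr (by linarith))).div_const _
  have h2 : Tendsto (fun n => fracPLaplaceIntegrand s p u (φs n) z) atTop
      (𝓝 (fracPLaplaceIntegrand s p u φ z)) := (hd.const_mul _).div_const _
  exact (h1.const_add _).sub (h2.const_mul p)

lemma measurable_youngGap (hp : 1 < p) (hu : Continuous u) (hφ : Continuous φ) :
    Measurable (youngGap s p u φ) :=
  (((measurable_energyDensity hu).const_mul _).add (measurable_energyDensity hφ)).sub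
    ((measurable_fracPLaplaceIntegrand hp hu hφ).const_mul _)

/-- Fatou applies to the Young gap, which is nonnegative. The energies of the approximants exceed
that of φ by a vanishing amount at most, so after cancellation only the one-sided bound on the
pairings remains. -/
lemma le_integral_fracPLaplaceIntegrand_of_tendsto (hp : 1 < p) (hu : u ∈ spaceW N s p)
    (hφ : φ ∈ spaceW N s p) {φs : ℕ → EuclideanSpace ℝ (Fin N) → ℝ} {e : ℕ → ℝ} {ℓ : ℝ}
    (hφs : ∀ n, φs n ∈ spaceW N s p) (he : Tendsto e atTop (𝓝 0))
    (hE : ∀ n, slobodeckiiPow s p (φs n) ≤ slobodeckiiPow s p φ + ENNReal.ofReal (e n))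
    (hlim : ∀ x, Tendsto (fun n => φs n x) atTop (𝓝 (φ x)))
    (hℓ : Tendsto (fun n => ∫ z, fracPLaplaceIntegrand s p u (φs n) z) atTop (𝓝 ℓ)) :
    ℓ ≤ ∫ z, fracPLaplaceIntegrand s p u φ z := by
  -- The maximum with 0 appears because `ENNReal.ofReal` truncates negative `e n`.
  set b : ℕ → ℝ := fun n => (p - 1) * (∫ z, energyDensity s p u z) +
    ((∫ z, energyDensity s p φ z) + max (e n) 0) -
      p * ∫ z, fracPLaplaceIntegrand s p u (φs n) z with hb
  have hbound : ∀ n, ∫ z, youngGap s p u (φs n) z ≤ b n := fun n => by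
    have h := hE n
    have h0 : 0 ≤ ∫ z, energyDensity s p φ z := integral_nonneg (energyDensity_nonneg s p φ)
    rw [slobodeckiiPow_eq_ofReal (hφs n), slobodeckiiPow_eq_ofReal hφ,
      ← ENNReal.ofReal_toReal (ENNReal.ofReal_ne_top (r := e n)), ENNReal.toReal_ofReal',
      ← ENNReal.ofReal_add h0 (le_max_right _ _),
      ENNReal.ofReal_le_ofReal_iff (add_nonneg h0 (le_max_right _ _))] at h
    rw [integral_youngGap hp hu (hφs n)]
    simp only [hb]
    linarith
  have hb0 : ∀ n, 0 ≤ b n := fun n =>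
    (integral_nonneg fun z => youngGap_nonneg hp u (φs n) z).trans (hbound n)
  have hblim : Tendsto b atTop (𝓝 ((p - 1) * (∫ z, energyDensity s p u z) +
      (∫ z, energyDensity s p φ z) - p * ℓ)) := by
    have hm : Tendsto (fun n => max (e n) 0) atTop (𝓝 0) := by
      simpa using he.max (tendsto_const_nhds (x := (0 : ℝ)))
    simpa using ((hm.const_add _).const_add _).sub (hℓ.const_mul p)
  have hfatou : ∫⁻ z, ENNReal.ofReal (youngGap s p u φ z) ≤
      ENNReal.ofReal ((p - 1) * (∫ z, energyDensity s p u z) +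
        (∫ z, energyDensity s p φ z) - p * ℓ) :=
    calc ∫⁻ z, ENNReal.ofReal (youngGap s p u φ z)
        = ∫⁻ z, liminf (fun n => ENNReal.ofReal (youngGap s p u (φs n) z)) atTop :=
          lintegral_congr fun z =>
            (ENNReal.tendsto_ofReal (tendsto_youngGap hp hlim z)).liminf_eq.symm
      _ ≤ liminf (fun n => ∫⁻ z, ENNReal.ofReal (youngGap s p u (φs n) z)) atTop :=
          lintegral_liminf_le fun n =>
            (measurable_youngGap hp hu.1 (hφs n).1).ennreal_ofReal
      _ ≤ liminf (fun n => ENNReal.ofReal (b n)) atTop :=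
          liminf_le_liminf (Eventually.of_forall fun n => by
            rw [lintegral_youngGap hp hu (hφs n)]
            exact ENNReal.ofReal_le_ofReal (hbound n))
      _ = _ := (ENNReal.tendsto_ofReal hblim).liminf_eq
  rw [lintegral_youngGap hp hu hφ, integral_youngGap hp hu hφ,
    ENNReal.ofReal_le_ofReal_iff (ge_of_tendsto' hblim hb0)] at hfatou
  nlinarith

lemma le_integral_of_weaklySolves_testFunctions (hN : 1 ≤ N) (hs0 : 0 < s) (hs1 : s < 1)
    (hp : 1 < p) (hsp : (N : ℝ) < s * p) (hu : u ∈ spaceW N s p)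
    (h : WeaklySolves (testFunctions N) s p u c x₀ y₀) (hφ : φ ∈ spaceW N s p) :
    c * (φ x₀ - φ y₀) ≤ ∫ z, fracPLaplaceIntegrand s p u φ z := by
  obtain ⟨φs, e, he, hφs, hE, hlim⟩ := exists_seq_testFunctions hN hs0 hs1 hp hsp hφ
  refine le_integral_fracPLaplaceIntegrand_of_tendsto hp hu hφ
    (fun n => testFunctions_subset_spaceW hN hs0 hs1 hp hsp (hφs n)) he hE hlim ?_
  simp_rw [fun n => (h (φs n) (hφs n)).2]
  exact ((hlim x₀).sub (hlim y₀)).const_mul c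

/-- The one-sided bound for φ and for -φ gives equality, because the weak form is linear in φ. -/
lemma WeaklySolves.spaceW_of_testFunctions (hN : 1 ≤ N) (hs0 : 0 < s) (hs1 : s < 1) (hp : 1 < p)
    (hsp : (N : ℝ) < s * p) (hu : u ∈ spaceW N s p)
    (h : WeaklySolves (testFunctions N) s p u c x₀ y₀) :
    WeaklySolves (spaceW N s p) s p u c x₀ y₀ := fun φ hφ => by
  refine ⟨integrable_fracPLaplaceIntegrand hp hu hφ, le_antisymm ?_
    (le_integral_of_weaklySolves_testFunctions hN hs0 hs1 hp hsp hu h hφ)⟩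
  have := le_integral_of_weaklySolves_testFunctions hN hs0 hs1 hp hsp hu h
    (smul_mem_spaceW (-1) hφ)
  rw [fracPLaplaceIntegrand_smul] at this
  simp only [Pi.smul_apply, smul_eq_mul, integral_const_mul] at this
  linarith

end Extension

/-! ### Extremals and two-point minimizers -/

section Extremal

variable {u v φ : EuclideanSpace ℝ (Fin N) → ℝ} {x₀ y₀ : EuclideanSpace ℝ (Fin N)}

lemma isMinOn_of_isExtremal (hN : 1 ≤ N) (hs0 : 0 < s) (hs1 : s < 1) (hp : 1 < p)
    (hsp : (N : ℝ) < s * p) (hu : IsExtremal s p u) (hmax : HolderMaximizedAt s p u x₀ y₀) :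
    IsMinOn (slobodeckiiPow s p) (admissible s p x₀ y₀ (u x₀) (u y₀)) u := fun v hv => by
  have h : holderSeminorm (morreyExponent N s p) u ≤ holderSeminorm (morreyExponent N s p) v := by
    rw [hmax, holderRatio, ← hv.2.1, ← hv.2.2]
    exact holderRatio_le_holderSeminorm _ v x₀ y₀
  change slobodeckiiPow s p u ≤ slobodeckiiPow s p v
  rw [hu.2.2]
  refine le_trans ?_ (morreyConst_mul_le hN hs0 hs1 hp hsp hv.1)
  have : 0 ≤ p := by linarith
  gcongr

/-- A similarity sends (x₀, y₀) to (a, b); composing φ with it, multiplying by `K` and adding a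
constant gives a competitor. Its energy and its quotient to the power p carry the same factor (|K|
l^α)^p. -/
lemma slobodeckiiPow_mul_holderRatio_le (hp : 1 < p) (hxy : x₀ ≠ y₀)
    (hmin : IsMinOn (slobodeckiiPow s p) (admissible s p x₀ y₀ (u x₀) (u y₀)) u)
    (hφ : φ ∈ spaceW N s p) {a b : EuclideanSpace ℝ (Fin N)} (hab : a ≠ b) :
    slobodeckiiPow s p u * holderRatio (morreyExponent N s p) φ a b ^ p ≤
      slobodeckiiPow s p φ * holderRatio (morreyExponent N s p) u x₀ y₀ ^ p := by
  have hp0 : 0 < p := by linarith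
  rcases eq_or_ne (φ a) (φ b) with h | h
  · simp [holderRatio, h, hp0]
  obtain ⟨r, l, c, hl, rfl, rfl⟩ := exists_similarity hxy hab
  have hd : φ (l • r x₀ + c) - φ (l • r y₀ + c) ≠ 0 := sub_ne_zero.2 h
  set K := (u x₀ - u y₀) / (φ (l • r x₀ + c) - φ (l • r y₀ + c)) with hK
  set T := compSimilarity φ r l c with hT
  have hTW : T ∈ spaceW N s p := compSimilarity_mem_spaceW r c hl hφ
  have hKT : K * T x₀ - K * T y₀ = u x₀ - u y₀ := by
    rw [← mul_sub, hK]
    exact div_mul_cancel₀ _ hd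
  set κ : EuclideanSpace ℝ (Fin N) → ℝ := fun _ => u y₀ - K * T y₀ with hκ
  have hadm : K • T + κ ∈ admissible s p x₀ y₀ (u x₀) (u y₀) := by
    refine ⟨add_mem_spaceW hp0.le (smul_mem_spaceW K hTW) (const_mem_spaceW hp0.ne' _), ?_, ?_⟩
    · simp only [Pi.add_apply, Pi.smul_apply, smul_eq_mul, hκ]; linarith
    · simp only [Pi.add_apply, Pi.smul_apply, smul_eq_mul, hκ]; ring
  have hE : slobodeckiiPow s p (K • T + κ) =
      (ENNReal.ofReal |K| * ENNReal.ofReal (l ^ morreyExponent N s p)) ^ p *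
        slobodeckiiPow s p φ := by
    rw [show slobodeckiiPow s p (K • T + κ) = slobodeckiiPow s p (K • T) by
      simp [slobodeckiiPow, hκ], slobodeckiiPow_smul, hT, slobodeckiiPow_compSimilarity r c hφ.1 hl,
      ENNReal.mul_rpow_of_nonneg _ _ hp0.le, ENNReal.ofReal_rpow_of_nonneg (abs_nonneg _) hp0.le,
      ENNReal.ofReal_rpow_of_nonneg (by positivity) hp0.le, ← Real.rpow_mul hl.le,
      morreyExponent_mul hp, mul_assoc]
  have hratio : holderRatio (morreyExponent N s p) u x₀ y₀ = ENNReal.ofReal |K| *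
      ENNReal.ofReal (l ^ morreyExponent N s p) *
        holderRatio (morreyExponent N s p) φ (l • r x₀ + c) (l • r y₀ + c) := by
    rw [mul_assoc, ← holderRatio_compSimilarity r c _ hl, ← holderRatio_smul]
    simp only [holderRatio, Pi.smul_apply, smul_eq_mul]
    rw [← hT, hKT]
  have hle : slobodeckiiPow s p u ≤ slobodeckiiPow s p (K • T + κ) := hmin hadm
  rw [hE] at hle
  rw [hratio, ENNReal.mul_rpow_of_nonneg _ _ hp0.le, ← mul_assoc, mul_comm (slobodeckiiPow s p φ)]
  gcongr

lemma slobodeckiiPow_mul_holderSeminorm_le (hp : 1 < p) (hxy : x₀ ≠ y₀)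
    (hmin : IsMinOn (slobodeckiiPow s p) (admissible s p x₀ y₀ (u x₀) (u y₀)) u)
    (hφ : φ ∈ spaceW N s p) :
    slobodeckiiPow s p u * holderSeminorm (morreyExponent N s p) φ ^ p ≤
      slobodeckiiPow s p φ * holderRatio (morreyExponent N s p) u x₀ y₀ ^ p :=
  mul_holderSeminorm_rpow_le (by linarith)
    (ENNReal.mul_ne_top hφ.2.2.ne (ENNReal.rpow_ne_top_of_nonneg (by linarith)
      ENNReal.ofReal_ne_top))
    fun _ _ hab => slobodeckiiPow_mul_holderRatio_le hp hxy hmin hφ hab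

lemma isExtremal_of_isMinOn (hN : 1 ≤ N) (hs0 : 0 < s) (hs1 : s < 1) (hp : 1 < p)
    (hsp : (N : ℝ) < s * p) (hxy : x₀ ≠ y₀) (hu : u ∈ spaceW N s p) (hnc : IsNonconstant u)
    (hmin : IsMinOn (slobodeckiiPow s p) (admissible s p x₀ y₀ (u x₀) (u y₀)) u) :
    IsExtremal s p u ∧ HolderMaximizedAt s p u x₀ y₀ := by
  have hp0 : 0 < p := by linarith
  have hE0 : slobodeckiiPow s p u ≠ 0 := by
    rw [slobodeckiiPow_eq_ofReal hu]
    exact (ENNReal.ofReal_pos.2 (integral_energyDensity_pos hp hu hnc)).ne'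
  have hmax : HolderMaximizedAt s p u x₀ y₀ := by
    refine le_antisymm ?_ (holderRatio_le_holderSeminorm _ _ _ _)
    -- Comparing u with itself and cancelling its finite positive energy shows that no pair beats
    -- (x₀, y₀).
    have h := slobodeckiiPow_mul_holderSeminorm_le hp hxy hmin hu
    rwa [ENNReal.mul_le_mul_iff_right hE0 hu.2.2.ne, ENNReal.rpow_le_rpow_iff hp0] at h
  refine ⟨⟨hu, hnc, le_antisymm ?_ (morreyConst_mul_le hN hs0 hs1 hp hsp hu)⟩, hmax⟩
  set H := holderSeminorm (morreyExponent N s p) u with hH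
  have hHtop : H ^ p ≠ ⊤ := ENNReal.rpow_ne_top_of_nonneg hp0.le hu.2.1.ne
  have hr : 0 < |u x₀ - u y₀| / ‖x₀ - y₀‖ ^ morreyExponent N s p :=
    div_pos (abs_pos.2 (sub_ne_zero.2 (ne_of_isMinOn hp hu hnc hmin)))
      (Real.rpow_pos_of_pos (norm_pos_iff.2 (sub_ne_zero.2 hxy)) _)
  have hH0 : H ^ p ≠ 0 := by
    have : H ≠ 0 := by
      rw [hH, hmax]
      exact (ENNReal.ofReal_pos.2 hr).ne'
    simp [this, hp0.not_gt]
  rw [← ENNReal.div_le_iff hH0 hHtop]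
  refine le_iInf₂ fun φ hφ => ?_
  rw [ENNReal.div_le_iff hH0 hHtop]
  -- The same comparison, now with a normalized test function, bounds the quotient of u by every
  -- candidate in the infimum.
  have h := slobodeckiiPow_mul_holderSeminorm_le hp hxy hmin
    (testFunctions_subset_spaceW hN hs0 hs1 hp hsp hφ.1)
  rwa [hφ.2, ENNReal.one_rpow, mul_one, ← hmax] at h

end Extremal

end FractionalMorrey

/-! ### The equivalences and uniqueness -/

theorem theorem7p3 (N : ℕ) (hN : 1 ≤ N) (s p : ℝ) (hs0 : 0 < s) (hs1 : s < 1) (hp : 1 < p)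
    (hsp : (N : ℝ) < s * p) (x₀ y₀ : EuclideanSpace ℝ (Fin N)) (hxy : x₀ ≠ y₀) :
    (∀ u : EuclideanSpace ℝ (Fin N) → ℝ, List.TFAE [
      -- (i)
      FractionalMorrey.IsExtremal s p u ∧ FractionalMorrey.HolderMaximizedAt s p u x₀ y₀,
      -- (ii), tested against the whole space 𝒲^{s,p}
      u ∈ FractionalMorrey.spaceW N s p ∧ ∃ c : ℝ, c ≠ 0 ∧
        FractionalMorrey.WeaklySolves (FractionalMorrey.spaceW N s p) s p u c x₀ y₀,
      -- (ii), tested against C_0^∞ only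
      u ∈ FractionalMorrey.spaceW N s p ∧ ∃ c : ℝ, c ≠ 0 ∧
        FractionalMorrey.WeaklySolves (FractionalMorrey.testFunctions N) s p u c x₀ y₀,
      -- (iii)
      u ∈ FractionalMorrey.spaceW N s p ∧ FractionalMorrey.IsNonconstant u ∧
        FractionalMorrey.IsUniqueMinimizer (FractionalMorrey.slobodeckiiPow s p)
          (FractionalMorrey.admissible s p x₀ y₀ (u x₀) (u y₀)) u]) ∧
    -- uniqueness of extremals
    (∀ u v : EuclideanSpace ℝ (Fin N) → ℝ,
      FractionalMorrey.IsExtremal s p u → FractionalMorrey.HolderMaximizedAt s p u x₀ y₀ →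
      FractionalMorrey.IsExtremal s p v → FractionalMorrey.HolderMaximizedAt s p v x₀ y₀ →
      ∀ C : ℝ, C ≠ 0 → u x₀ = C * v x₀ → u y₀ = C * v y₀ → ∀ x, u x = C * v x) := by
  open FractionalMorrey in
  have h12 : ∀ u : EuclideanSpace ℝ (Fin N) → ℝ, IsExtremal s p u →
      HolderMaximizedAt s p u x₀ y₀ →
      ∃ c : ℝ, c ≠ 0 ∧ WeaklySolves (spaceW N s p) s p u c x₀ y₀ := fun u hu hmax =>
    exists_weaklySolves_of_isMinOn hp hu.1 hu.2.1
      (isMinOn_of_isExtremal hN hs0 hs1 hp hsp hu hmax)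
  open FractionalMorrey in
  refine ⟨fun u => ?_, fun u v hu humax hv hvmax C hC hx hy => ?_⟩
  · tfae_have 1 → 2 := fun ⟨hu, hmax⟩ => ⟨hu.1, h12 u hu hmax⟩
    tfae_have 2 → 3 := fun ⟨hu, c, hc, h⟩ => ⟨hu, c, hc, fun φ hφ =>
      h φ (testFunctions_subset_spaceW hN hs0 hs1 hp hsp hφ)⟩
    tfae_have 3 → 2 := fun ⟨hu, c, hc, h⟩ =>
      ⟨hu, c, hc, h.spaceW_of_testFunctions hN hs0 hs1 hp hsp hu⟩
    tfae_have 2 → 4 := fun ⟨hu, c, hc, h⟩ => by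
      obtain ⟨φ, hφ, hne⟩ := exists_mem_testFunctions_ne hxy
      exact ⟨hu, isNonconstant_of_weaklySolves hc
        (testFunctions_subset_spaceW hN hs0 hs1 hp hsp hφ) hne h,
        isUniqueMinimizer_of_weaklySolves hp hu h⟩
    tfae_have 4 → 1 := fun ⟨hu, hnc, h⟩ =>
      isExtremal_of_isMinOn hN hs0 hs1 hp hsp hxy hu hnc h.1.2
    tfae_finish
  · obtain ⟨c, -, hsol⟩ := h12 u hu humax
    have hmin := isUniqueMinimizer_of_weaklySolves hp hu.1 hsol
    have hadm : C • v ∈ admissible s p x₀ y₀ (u x₀) (u y₀) :=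
      ⟨smul_mem_spaceW C hv.1, hx.symm, hy.symm⟩
    have hH : holderSeminorm (morreyExponent N s p) u =
        ENNReal.ofReal |C| * holderSeminorm (morreyExponent N s p) v := by
      rw [humax, hvmax, ← holderRatio_smul]
      simp [holderRatio, hx, hy]
    -- For extremals the seminorm determines the energy, so C v has the minimal energy and
    -- uniqueness of the minimizer applies.
    have hE : slobodeckiiPow s p (C • v) = slobodeckiiPow s p u := by
      rw [slobodeckiiPow_smul, hu.2.2, hv.2.2, hH, ENNReal.mul_rpow_of_nonneg _ _ (by linarith),
        ENNReal.ofReal_rpow_of_nonneg (abs_nonneg C) (by linarith)]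
      ring
    have := hmin.2 (C • v) ⟨hadm, fun w hw => by
      change slobodeckiiPow s p (C • v) ≤ slobodeckiiPow s p w
      rw [hE]; exact hmin.1.2 hw⟩
    exact fun x => (congrFun this x).symm
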